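/- A nondeterministic parity transducer $T$ has a finite set $Q$ of states with an initial state $q_0$, finite nonempty input and output alphabets $\Sigma$ and $\Gamma$, a finite set of transitions $\Delta\subseteq Q\times\Sigma^*\times\Gamma^*\times Q$ and a priority function $c\colon Q\to\mathbb N$. A run is accepting if the largest priority that it visits infinitely often is even. The rational relation $R(T)\subseteq\Sigma^\omega\times\Gamma^\omega$ consists of all pairs $(\alpha,\beta)$ of infinite words such that some accepting infinite run from $q_0$ has input labels that concatenate to $\alpha$ and output labels that concatenate to $\beta$. Its domain is $\mathrm{dom}(R)=\{\alpha\mid\exists\beta\ (\alpha,\beta)\in R\}$. A partial function $f\colon\Sigma^\omega\to\Gamma^\omega$ uniformizes $R$ if $\mathrm{dom}(f)=\mathrm{dom}(R)$ and $(\alpha,f(\alpha))\in R$ for all $\alpha\in\mathrm{dom}(f)$. Writing $|\alpha\wedge\beta|$ for the length of the longest common prefix of $\alpha$ and $\beta$, a partial function $f\colon\Sigma^\omega\to\Gamma^\omega$ is called - continuous, if $\forall\alpha\in\mathrm{dom}(f)\ \forall i\in\mathbb N\ \exists j\in\mathbb N\ \forall\beta\in\mathrm{dom}(f)\colon |\alpha\wedge\beta|\ge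 j\rightarrow|f(\alpha)\wedge f(\beta)|\ge i$; - computable, if there is a deterministic Turing machine with a read-only one-way input tape, a two-way working tape and a write-only one-way output tape that, for every $\alpha\in\mathrm{dom}(f)$ on its input tape, writes exactly the infinite word $f(\alpha)$ on its output tape; - sequential, if it is recognized by a finite one-way input-deterministic transducer with a parity acceptance condition, that is, one with a partial transition function $Q\times\Sigma\to Q\times\Gamma^*$ such that $f(\alpha)=\beta$ iff the run on $\alpha$ is infinite and accepting and its outputs concatenate to the infinite word $\beta$; - letter-to-letter sequential, if it is recognized by such a transducer in which every transition outputs exactly one letter. **Theorem.** For each of the four classes (continuous, computable, sequential, letter-to-letter sequential functions) the following problem is undecidable: given a nondeterministic parity transducer $T$, is $R(T)$ uniformizable by a function of the class? This remains true for relations with total domain: for none of the four classes is there an algorithm that halts with the correct answer on every transducer $T$ with $\mathrm{dom}(R(T))=\Sigma^\omega$ (whatever it does on other inputs). -/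

import Mathlib

open Filter

namespace OmegaUnif

/-! ## Infinite words, relations, partial functions -/

/-- Infinite words over the alphabet `A`. -/
abbrev OmegaWord (A : Type) : Type := ℕ → A

/-- `|α ∧ β| ≥ j`: the longest common prefix of `α` and `β` has length at least `j`. -/
def AgreeUpTo {A : Type} (j : ℕ) (α β : OmegaWord A) : Prop := ∀ n < j, α n = β n

/-- The finite word `u` is a prefix of the infinite word `α`. -/
def IsPrefixOf {A : Type} (u : List A) (α : OmegaWord A) : Prop :=
  ∀ (n : ℕ) (h : n < u.length), u[n] = α n

/-- `u 0, u 1, u 2, …` concatenates to the infinite word `α`: every finite concatenation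
`u 0 ⋯ u (n-1)` is a prefix of `α`, and the lengths of these are unbounded. -/
def ConcatEq {A : Type} (u : ℕ → List A) (α : OmegaWord A) : Prop :=
  (∀ n, IsPrefixOf ((List.range n).flatMap u) α) ∧
    ∀ i, ∃ n, i ≤ ((List.range n).flatMap u).length

/-- Parity condition: the maximal number that occurs infinitely often in `p` is even. -/
def ParityAccepting (p : ℕ → ℕ) : Prop :=
  ∃ m, Even m ∧ (∃ᶠ i in atTop, p i = m) ∧ ∀ᶠ i in atTop, p i ≤ m

/-- The domain of a relation. -/
def relDom {A B : Type} (R : OmegaWord A → OmegaWord B → Prop) : Set (OmegaWord A) :=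
  {α | ∃ β, R α β}

/-- The partial function `f` uniformizes `R`: it has the same domain and selects, for each
word of the domain, an image that is related to it. -/
def Uniformizes {A B : Type} (f : OmegaWord A →. OmegaWord B)
    (R : OmegaWord A → OmegaWord B → Prop) : Prop :=
  f.Dom = relDom R ∧ ∀ α β, β ∈ f α → R α β

/-! ## Rational relations: nondeterministic parity transducers -/

/-- A nondeterministic parity transducer with states `Q`, input alphabet `A` and output
alphabet `B`: finitely many transitions `(p, u, v, q)` with finite words `u`, `v`
(possibly empty), and a priority for each state. -/
structure ParityTransducer (Q A B : Type) where
  start : Q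
  trans : Finset (Q × List A × List B × Q)
  prio : Q → ℕ

/-- The relation `R(T)` of infinite words recognized by `T`: there is an infinite run
`q 0 –u 0/v 0→ q 1 –u 1/v 1→ q 2 ⋯` from the initial state that satisfies the parity
condition and whose input and output labels concatenate to `α` and `β`. -/
def ParityTransducer.rel {Q A B : Type} (T : ParityTransducer Q A B)
    (α : OmegaWord A) (β : OmegaWord B) : Prop :=
  ∃ (q : ℕ → Q) (u : ℕ → List A) (v : ℕ → List B),
    q 0 = T.start ∧ (∀ i, (q i, u i, v i, q (i + 1)) ∈ T.trans) ∧
    ConcatEq u α ∧ ConcatEq v β ∧ ParityAccepting (fun i => T.prio (q i))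

/-! ## Classes of functions -/

/-- Continuous functions of infinite words. -/
def IsContinuousFun {A B : Type} (f : OmegaWord A →. OmegaWord B) : Prop :=
  ∀ α fα, fα ∈ f α → ∀ i : ℕ, ∃ j : ℕ, ∀ β fβ, fβ ∈ f β →
    AgreeUpTo j α β → AgreeUpTo i fα fβ

/-- A deterministic Turing machine over infinite inputs, with a read-only one-way input tape,
a two-way working tape and a write-only one-way output tape. From the current state, the
scanned input letter and the scanned working symbol it determines (unless it halts) the next
state, the working symbol to write, the direction in which to move the working head, whether
the input head advances by one cell, and at most one letter to append to the output. -/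
structure OmegaMachine (A B : Type) where
  State : Type
  [finState : Finite State]
  Sym : Type
  [finSym : Finite Sym]
  [blank : Inhabited Sym]
  start : State
  step : State → A → Sym → Option (State × Sym × Turing.Dir × Bool × Option B)

attribute [instance] OmegaMachine.finState OmegaMachine.finSym OmegaMachine.blank

/-- Configurations: state, working tape, position of the input head, output so far. -/
structure OmegaMachine.Cfg {A B : Type} (M : OmegaMachine A B) where
  state : M.State
  tape : Turing.Tape M.Sym
  pos : ℕ
  out : List B

/-- One computation step on input `α`; a halted machine stays where it is. -/
def OmegaMachine.next {A B : Type} (M : OmegaMachine A B) (α : OmegaWord A)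
    (c : M.Cfg) : M.Cfg :=
  match M.step c.state (α c.pos) c.tape.head with
  | none => c
  | some (q, s, d, adv, o) =>
      { state := q
        tape := (c.tape.write s).move d
        pos := if adv then c.pos + 1 else c.pos
        out := c.out ++ o.toList }

/-- The configuration after `t` steps on input `α`, starting with a blank working tape. -/
def OmegaMachine.run {A B : Type} (M : OmegaMachine A B) (α : OmegaWord A) : ℕ → M.Cfg
  | 0 => { state := M.start, tape := default, pos := 0, out := [] }
  | t + 1 => M.next α (M.run α t)

/-- On input `α`, the machine writes exactly the infinite word `β` on its output tape. -/
def OmegaMachine.Outputs {A B : Type} (M : OmegaMachine A B) (α : OmegaWord A)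
    (β : OmegaWord B) : Prop :=
  (∀ t, IsPrefixOf (M.run α t).out β) ∧ ∀ i, ∃ t, i ≤ (M.run α t).out.length

/-- Computable functions of infinite words: some machine writes `f α` on each input `α` in the
domain of `f` (its behaviour on other inputs is irrelevant). -/
def IsComputableFun {A B : Type} (f : OmegaWord A →. OmegaWord B) : Prop :=
  ∃ M : OmegaMachine A B, ∀ α β, β ∈ f α → M.Outputs α β

/-- A sequential transducer: one-way, input-deterministic (each transition reads one letter and
the next state and the finite output word are determined by the state and this letter; the
transition function may be partial), with a parity acceptance condition. -/
structure SeqTransducer (Q A B : Type) where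
  start : Q
  step : Q → A → Option (Q × List B)
  prio : Q → ℕ

/-- The transducer has an accepting run on `α`, and this run produces `β`. -/
def SeqTransducer.Outputs {Q A B : Type} (S : SeqTransducer Q A B)
    (α : OmegaWord A) (β : OmegaWord B) : Prop :=
  ∃ (q : ℕ → Q) (v : ℕ → List B),
    q 0 = S.start ∧ (∀ i, S.step (q i) (α i) = some (q (i + 1), v i)) ∧
    ConcatEq v β ∧ ParityAccepting (fun i => S.prio (q i))

/-- Every transition writes exactly one letter. -/
def SeqTransducer.IsLetterToLetter {Q A B : Type} (S : SeqTransducer Q A B) : Prop :=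
  ∀ q a q' v, S.step q a = some (q', v) → v.length = 1

/-- Sequential functions: those recognized (domain included) by a finite sequential
transducer. -/
def IsSequentialFun {A B : Type} (f : OmegaWord A →. OmegaWord B) : Prop :=
  ∃ (Q : Type) (_ : Finite Q) (S : SeqTransducer Q A B),
    ∀ α β, β ∈ f α ↔ S.Outputs α β

/-- Letter-to-letter sequential functions. -/
def IsLetterToLetterSequentialFun {A B : Type} (f : OmegaWord A →. OmegaWord B) : Prop :=
  ∃ (Q : Type) (_ : Finite Q) (S : SeqTransducer Q A B),
    S.IsLetterToLetter ∧ ∀ α β, β ∈ f α ↔ S.Outputs α β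

/-! ## Transducers as inputs of algorithms -/

/-- A finite description of a parity transducer with states `0, …, stateMax`, input alphabet
`{0, …, inMax}` and output alphabet `{0, …, outMax}`: initial state, list of transitions and
list of the priorities of the states. -/
structure TransducerCode where
  stateMax : ℕ
  inMax : ℕ
  outMax : ℕ
  start : ℕ
  trans : List (ℕ × List ℕ × List ℕ × ℕ)
  prio : List ℕ

/-- A description is just a tuple of numbers and lists. -/
def TransducerCode.equivTuple : TransducerCode ≃
    ℕ × ℕ × ℕ × ℕ × List (ℕ × List ℕ × List ℕ × ℕ) × List ℕ where
  toFun c := (c.stateMax, c.inMax, c.outMax, c.start, c.trans, c.prio)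
  invFun t := ⟨t.1, t.2.1, t.2.2.1, t.2.2.2.1, t.2.2.2.2.1, t.2.2.2.2.2⟩
  left_inv _ := rfl
  right_inv _ := rfl

instance : Primcodable TransducerCode := Primcodable.ofEquiv _ TransducerCode.equivTuple

abbrev TransducerCode.States (c : TransducerCode) : Type := Fin (c.stateMax + 1)
abbrev TransducerCode.InAlph (c : TransducerCode) : Type := Fin (c.inMax + 1)
abbrev TransducerCode.OutAlph (c : TransducerCode) : Type := Fin (c.outMax + 1)

/-- The transducer described by a code. So that every code describes a transducer, numbers out
of range are reduced modulo the size of the respective set and missing priorities are `0`. -/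
def TransducerCode.toTransducer (c : TransducerCode) :
    ParityTransducer c.States c.InAlph c.OutAlph where
  start := Fin.ofNat _ c.start
  trans := (c.trans.map fun t =>
    (Fin.ofNat _ t.1, t.2.1.map (Fin.ofNat _), t.2.2.1.map (Fin.ofNat _),
      Fin.ofNat _ t.2.2.2)).toFinset
  prio q := c.prio.getD q 0

/-- Every parity transducer (over initial segments of `ℕ`) is described by a code. -/
theorem exists_code {n k m : ℕ}
    (T : ParityTransducer (Fin (n + 1)) (Fin (k + 1)) (Fin (m + 1))) :
    ∃ s t p, (TransducerCode.mk n k m s t p).toTransducer = T := by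
  refine ⟨T.start, T.trans.toList.map fun t =>
    (t.1.val, t.2.1.map Fin.val, t.2.2.1.map Fin.val, t.2.2.2.val), List.ofFn T.prio, ?_⟩
  obtain ⟨s, t, p⟩ := T
  have hp : (fun q : Fin (n + 1) => (List.ofFn p).getD q 0) = p := by
    funext q
    simp [List.getD, -List.ofFn_succ, Nat.le_of_lt_succ q.isLt]
  simp only [TransducerCode.toTransducer, hp]
  simp [Function.comp_def]

/-- The rational relation given by a code. -/
def TransducerCode.rel (c : TransducerCode) :
    OmegaWord c.InAlph → OmegaWord c.OutAlph → Prop := c.toTransducer.rel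

/-- The relation has total domain: each input word is related to some output word. -/
def TransducerCode.HasTotalDomain (c : TransducerCode) : Prop := relDom c.rel = Set.univ

/-- A class of functions of infinite words, for all alphabets. -/
abbrev FunClass : Type 1 := ∀ {A B : Type}, (OmegaWord A →. OmegaWord B) → Prop

/-- The relation given by the code is uniformizable by a function of the class `C`. -/
def TransducerCode.UniformizableBy (C : FunClass) (c : TransducerCode) : Prop :=
  ∃ f : OmegaWord c.InAlph →. OmegaWord c.OutAlph, C f ∧ Uniformizes f c.rel

/-- Decidability of the problem `P` restricted to the instances that satisfy `I`: some algorithm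
halts with the correct answer on every instance in `I` (and may do anything on others). -/
def DecidableOn {X : Type} [Primcodable X] (I P : X → Prop) : Prop :=
  ∃ f : X →. Bool, Partrec f ∧ ∀ x, I x → ∃ b, b ∈ f x ∧ (b = true ↔ P x)

end OmegaUnif

/-! The halting problem of a fixed Turing machine, on inputs numbered by `n`, is reduced to
uniformizability. The letter `0` is an end marker. A trace is a finite word without `0` that shows a
halting computation as rows of equal length, one per configuration, separated by `sep`. For each `n`
a checking transducer is built. It relates a word that stays `0` from its first `0` on (or contains
none) only to itself. A word `α = w 0 ⋯` with a later nonzero letter is related to `β` when a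
guessed defect is found: `w` has no correct first row, `w` has no halting letter, `β` begins with
`0` although `α` does not, or some letter of `β` violates the local rule applied to three letters of
`α` in the preceding row. The last test needs only finite memory: the output head is advanced by one
row, then both heads move in step. It compares consecutive rows of `w` as long as `β` repeats `w`.

Suppose that `w` is a trace (`not_uniformizableBy_continuous`). A uniformizer maps `w 0 0 0 ⋯` to
itself (`eq_of_accFrom`). If it is continuous, then its value on `w 0 ⋯ 0 sep ⋯`, with enough zeros,
begins with `w 0`, and no defect can be found (`IsTrace.not_accFrom`). If there is no trace, then
copying the input up to the first `0` and writing `0` forever is a uniformizer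
(`uniformizes_truncateFun`), since a defect of `w` is visible in every output that begins with `w 0`
(`accFrom_of_not_isTrace`). This function belongs to all four classes, and all members of these
classes are continuous, so one reduction serves them all. Its instances have total domain.

Traces correspond to halting computations (`eval_dom_of_isTrace`, `exists_isTrace_of_eval_dom`)
because the next content of a tape cell is a function of the cell and its two neighbours. The
machine comes from `exists_undecidable_machine`; its inputs encode `2 ^ n` in binary, so that the
first row is essentially unary in `n`. -/

namespace OmegaUnif

/-! ## Runs of transducers in terms of head positions -/

section Runs

variable {Q A B : Type}

/-- The finite word `u` occurs in `α` at position `i`. -/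
def MatchAt (α : OmegaWord A) : ℕ → List A → Prop
  | _, [] => True
  | i, a :: l => α i = a ∧ MatchAt α (i + 1) l

@[simp] theorem matchAt_nil (α : OmegaWord A) (i : ℕ) : MatchAt α i [] ↔ True := Iff.rfl

@[simp] theorem matchAt_cons (α : OmegaWord A) (i : ℕ) (a : A) (l : List A) :
    MatchAt α i (a :: l) ↔ α i = a ∧ MatchAt α (i + 1) l := Iff.rfl

theorem matchAt_iff (α : OmegaWord A) (i : ℕ) (u : List A) :
    MatchAt α i u ↔ ∀ (n : ℕ) (h : n < u.length), u[n] = α (i + n) := by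
  induction u generalizing i with
  | nil => simp
  | cons a l ih =>
    rw [matchAt_cons, ih]
    constructor
    · rintro ⟨h, h'⟩ (_ | n) hn
      · exact h.symm
      · simpa [add_assoc, add_comm 1 n] using h' n (by simpa using hn)
    · intro h
      refine ⟨(h 0 (by simp)).symm, fun n hn => ?_⟩
      have := h (n + 1) (by simpa using hn)
      rwa [List.getElem_cons_succ, ← add_assoc, add_right_comm] at this

theorem isPrefixOf_iff (α : OmegaWord A) (u : List A) : IsPrefixOf u α ↔ MatchAt α 0 u := by
  simp [matchAt_iff, IsPrefixOf]

theorem matchAt_append (α : OmegaWord A) (i : ℕ) (u v : List A) :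
    MatchAt α i (u ++ v) ↔ MatchAt α i u ∧ MatchAt α (i + u.length) v := by
  induction u generalizing i with
  | nil => simp
  | cons a l ih => simp [ih, and_assoc, add_assoc, add_comm 1]

theorem matchAt_replicate (α : OmegaWord A) (i n : ℕ) (a : A) :
    MatchAt α i (List.replicate n a) ↔ ∀ j < n, α (i + j) = a := by
  rw [matchAt_iff]
  simp [eq_comm]

/-- A transition, as a relation between configurations that consist of a state, the position of
the input head and the position of the output head. -/
def Step (tr : Q → List A → List B → Q → Prop) (α : OmegaWord A) (β : OmegaWord B)
    (c c' : Q × ℕ × ℕ) : Prop :=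
  ∃ u v, tr c.1 u v c'.1 ∧ MatchAt α c.2.1 u ∧ MatchAt β c.2.2 v ∧
    c'.2.1 = c.2.1 + u.length ∧ c'.2.2 = c.2.2 + v.length

/-- There is an infinite run from the configuration `c` that reads `α` and writes `β` completely
and visits the set `acc` of states infinitely often. -/
def AccFrom (tr : Q → List A → List B → Q → Prop) (acc : Q → Prop) (α : OmegaWord A)
    (β : OmegaWord B) (c : Q × ℕ × ℕ) : Prop :=
  ∃ r : ℕ → Q × ℕ × ℕ, r 0 = c ∧ (∀ t, Step tr α β (r t) (r (t + 1))) ∧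
    (∀ N, ∃ t, N ≤ (r t).2.1) ∧ (∀ N, ∃ t, N ≤ (r t).2.2) ∧ ∃ᶠ t in atTop, acc (r t).1

variable {tr : Q → List A → List B → Q → Prop} {acc : Q → Prop} {α : OmegaWord A}
  {β : OmegaWord B}

theorem AccFrom.of_step {c c' : Q × ℕ × ℕ} (hs : Step tr α β c c')
    (h : AccFrom tr acc α β c') : AccFrom tr acc α β c := by
  obtain ⟨r, h0, hr, hi, hk, ha⟩ := h
  refine ⟨fun t => Nat.casesOn t c r, rfl, ?_, fun N => ?_, fun N => ?_, ?_⟩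
  · rintro (_ | t)
    · simpa [h0] using hs
    · exact hr t
  · obtain ⟨t, ht⟩ := hi N
    exact ⟨t + 1, ht⟩
  · obtain ⟨t, ht⟩ := hk N
    exact ⟨t + 1, ht⟩
  · rw [frequently_atTop] at ha ⊢
    intro a
    obtain ⟨b, hb, hab⟩ := ha a
    exact ⟨b + 1, by omega, hab⟩

/-- Replaces the growing prefixes by local matches at the head positions, so that runs can be
treated one step at a time. -/
theorem concatEq_iff (u : ℕ → List A) (i : ℕ → ℕ) (h0 : i 0 = 0)
    (hi : ∀ t, i (t + 1) = i t + (u t).length) :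
    ConcatEq u α ↔ (∀ t, MatchAt α (i t) (u t)) ∧ ∀ N, ∃ t, N ≤ i t := by
  have hlen : ∀ n, ((List.range n).flatMap u).length = i n := by
    intro n
    induction n with
    | zero => simp [h0]
    | succ n ih => rw [List.range_succ, List.flatMap_append, List.length_append, ih, hi]; simp
  unfold ConcatEq
  simp only [hlen, isPrefixOf_iff]
  refine and_congr_left fun _ => ⟨fun h t => ?_, fun h n => ?_⟩
  · have := h (t + 1)
    rw [List.range_succ, List.flatMap_append, matchAt_append, hlen] at this
    simpa using this.2
  · induction n with
    | zero => simp
    | succ n ih =>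
      rw [List.range_succ, List.flatMap_append, matchAt_append, hlen]
      exact ⟨ih, by simpa using h n⟩

open Classical in
theorem parityAccepting_iff (P : ℕ → Prop) :
    ParityAccepting (fun t => if P t then 2 else 1) ↔ ∃ᶠ t in atTop, P t := by
  constructor
  · rintro ⟨m, hm, hf, -⟩
    refine hf.mono fun t ht => ?_
    by_contra hP
    simp only [if_neg hP] at ht
    exact absurd hm (by rw [← ht]; decide)
  · intro h
    refine ⟨2, by decide, h.mono fun t ht => if_pos ht, Eventually.of_forall fun t => ?_⟩
    dsimp only
    split_ifs <;> omega

-- With priorities 1 and 2 only, the parity condition asks for infinitely many visits to `acc`. The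
-- head positions are the partial sums of the label lengths.
open Classical in
theorem ParityTransducer.rel_iff_accFrom {Q' : Type} (T : ParityTransducer Q' A B) (e : Q ≃ Q')
    (htr : ∀ q u v q', (e q, u, v, e q') ∈ T.trans ↔ tr q u v q')
    (hp : ∀ q, T.prio (e q) = if acc q then 2 else 1) (s : Q) (hs : T.start = e s) :
    T.rel α β ↔ AccFrom tr acc α β (s, 0, 0) := by
  constructor
  · rintro ⟨q, u, v, h0, ht, hu, hv, hpar⟩
    let i : ℕ → ℕ := fun t => ∑ j ∈ Finset.range t, (u j).length
    let k : ℕ → ℕ := fun t => ∑ j ∈ Finset.range t, (v j).length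
    have hi : ∀ t, i (t + 1) = i t + (u t).length := fun t => Finset.sum_range_succ _ _
    have hk : ∀ t, k (t + 1) = k t + (v t).length := fun t => Finset.sum_range_succ _ _
    rw [concatEq_iff u i rfl hi] at hu
    rw [concatEq_iff v k rfl hk] at hv
    refine ⟨fun t => (e.symm (q t), i t, k t), by simp [h0, hs, i, k], fun t => ?_, hu.2, hv.2, ?_⟩
    · exact ⟨u t, v t, by simpa [← htr] using ht t, hu.1 t, hv.1 t, hi t, hk t⟩
    · rw [← parityAccepting_iff]
      convert! hpar using 2
      rw [← hp, Equiv.apply_symm_apply]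
  · rintro ⟨r, h0, hr, hi, hk, ha⟩
    choose u v h1 h2 h3 h4 h5 using hr
    refine ⟨fun t => e (r t).1, u, v, by simp [h0, hs], fun t => (htr _ _ _ _).2 (h1 t), ?_, ?_, ?_⟩
    · rw [concatEq_iff u (fun t => (r t).2.1) (by simp [h0]) h4]
      exact ⟨h2, hi⟩
    · rw [concatEq_iff v (fun t => (r t).2.2) (by simp [h0]) h5]
      exact ⟨h3, hk⟩
    · simp only [hp]
      rwa [parityAccepting_iff]

/-- An invariant of the steps holds along every run, and accepting configurations with arbitrarily
advanced input head satisfy it. -/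
theorem AccFrom.exists_invariant {c : Q × ℕ × ℕ} (h : AccFrom tr acc α β c)
    (J : Q → ℕ → ℕ → Prop) (h0 : J c.1 c.2.1 c.2.2)
    (hJ : ∀ q i k u v q', J q i k → tr q u v q' → MatchAt α i u → MatchAt β k v →
      J q' (i + u.length) (k + v.length)) (N : ℕ) :
    ∃ q i k, J q i k ∧ acc q ∧ N ≤ i := by
  obtain ⟨r, rfl, hr, hi, -, ha⟩ := h
  have hall : ∀ t, J (r t).1 (r t).2.1 (r t).2.2 := by
    intro t
    induction t with
    | zero => exact h0
    | succ t ih =>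
      obtain ⟨u, v, h1, h2, h3, h4, h5⟩ := hr t
      rw [h4, h5]
      exact hJ _ _ _ _ _ _ ih h1 h2 h3
  -- The input head never moves back, so an accepting visit after it has passed `N` still finds it
  -- there.
  have hmono : Monotone fun t => (r t).2.1 := by
    refine monotone_nat_of_le_succ fun t => ?_
    obtain ⟨u, v, -, -, -, h4, -⟩ := hr t
    omega
  obtain ⟨t, ht⟩ := hi N
  obtain ⟨t', htt', hacc⟩ := (frequently_atTop.1 ha) t
  exact ⟨_, _, _, hall t', hacc, ht.trans (hmono htt')⟩

end Runs

/-! ## Relations between the classes of functions -/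

section Classes

variable {A B : Type} {f : OmegaWord A →. OmegaWord B}

theorem IsLetterToLetterSequentialFun.isSequentialFun (h : IsLetterToLetterSequentialFun f) :
    IsSequentialFun f :=
  let ⟨Q, hQ, S, _, hS⟩ := h
  ⟨Q, hQ, S, hS⟩

/-- Each transition reads one letter, so the output of the first `j` transitions is determined by
the first `j` letters. -/
theorem IsSequentialFun.isContinuousFun (h : IsSequentialFun f) : IsContinuousFun f := by
  obtain ⟨Q, -, S, hS⟩ := h
  intro α fα hα i
  obtain ⟨q, v, h0, hq, hv, -⟩ := (hS _ _).1 hα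
  obtain ⟨j, hj⟩ := hv.2 i
  refine ⟨j, fun β fβ hβ hag => ?_⟩
  obtain ⟨q', v', h0', hq', hv', -⟩ := (hS _ _).1 hβ
  have hst : ∀ n ≤ j, q n = q' n := by
    intro n
    induction n with
    | zero => intro _; rw [h0, h0']
    | succ n ih =>
      intro hn
      have h1 := hq n
      have h2 := hq' n
      rw [ih (by omega), hag n (by omega), h2] at h1
      simpa using (congrArg Prod.fst (Option.some.inj h1)).symm
  have hout : ∀ n < j, v n = v' n := by
    intro n hn
    have h1 := hq n
    have h2 := hq' n
    rw [hst n hn.le, hag n hn, h2] at h1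
    simpa using (congrArg Prod.snd (Option.some.inj h1)).symm
  have heq : (List.range j).flatMap v = (List.range j).flatMap v' :=
    List.flatMap_congr fun n hn => hout n (by simpa using hn)
  intro n hn
  rw [← hv.1 j n (by omega), ← hv'.1 j n (by rw [← heq]; omega)]
  simp only [heq]

theorem OmegaMachine.run_pos_le (M : OmegaMachine A B) (α : OmegaWord A) (t : ℕ) :
    (M.run α t).pos ≤ t := by
  induction t with
  | zero => simp [run]
  | succ t ih =>
    simp only [run, next]
    split
    · omega
    · dsimp only
      split_ifs <;> omega

/-- The one-way input head scans only positions below `t` during the first `t` steps. -/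
theorem OmegaMachine.run_congr (M : OmegaMachine A B) {α β : OmegaWord A} {t : ℕ}
    (h : AgreeUpTo t α β) : M.run α t = M.run β t := by
  induction t with
  | zero => rfl
  | succ t ih =>
    have ht := ih fun n hn => h n (by omega)
    simp only [run, next]
    rw [← ht, ← h _ (Nat.lt_succ_of_le (M.run_pos_le α t))]

theorem IsComputableFun.isContinuousFun (h : IsComputableFun f) : IsContinuousFun f := by
  obtain ⟨M, hM⟩ := h
  intro α fα hα i
  obtain ⟨t, ht⟩ := (hM _ _ hα).2 i
  refine ⟨t, fun β fβ hβ hag n hn => ?_⟩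
  have heq := M.run_congr hag
  rw [← (hM _ _ hα).1 t n (by omega), ← (hM _ _ hβ).1 t n (by rw [← heq]; omega)]
  simp only [heq]

end Classes

/-! ## The function that copies its input up to the first `0` and continues with `0` -/

section Truncate

variable {m : ℕ}

open Classical in
/-- Keep the letters before the first `0` and replace the others by `0`. -/
noncomputable def truncate (α : OmegaWord (Fin (m + 1))) : OmegaWord (Fin (m + 1)) :=
  fun n => if ∃ j ≤ n, α j = 0 then 0 else α n

theorem truncate_congr {α β : OmegaWord (Fin (m + 1))} {n : ℕ}
    (h : ∀ j ≤ n, α j = β j) : truncate α n = truncate β n := by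
  have : (∃ j ≤ n, α j = 0) ↔ ∃ j ≤ n, β j = 0 :=
    exists_congr fun j => and_congr_right fun hj => by rw [h j hj]
  simp only [truncate, this, h n le_rfl]

theorem truncate_eq_self {α : OmegaWord (Fin (m + 1))} (h : ∀ i j, i ≤ j → α i = 0 → α j = 0) :
    truncate α = α := by
  funext n
  unfold truncate
  split_ifs with h'
  · obtain ⟨j, hj, h0⟩ := h'
    exact (h j n hj h0).symm
  · rfl

theorem truncate_of_le {α : OmegaWord (Fin (m + 1))} {e : ℕ} (h : ∀ j < e, α j ≠ 0)
    (he : α e = 0) {j : ℕ} (hj : j ≤ e) : truncate α j = α j := by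
  unfold truncate
  split_ifs with h'
  · obtain ⟨i, hi, h0⟩ := h'
    rcases hj.lt_or_eq with hlt | rfl
    · exact absurd h0 (h i (by omega))
    · exact he.symm
  · rfl

/-- `truncate` as a total partial function. -/
noncomputable def truncateFun (m : ℕ) : OmegaWord (Fin (m + 1)) →. OmegaWord (Fin (m + 1)) :=
  fun α => Part.some (truncate α)

theorem isContinuousFun_truncateFun : IsContinuousFun (truncateFun m) := by
  intro α fα hα i
  refine ⟨i, fun β fβ hβ hag n hn => ?_⟩
  rw [Part.mem_some_iff.1 hα, Part.mem_some_iff.1 hβ]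
  exact truncate_congr fun j hj => hag j (by omega)

-- One bit of memory, telling whether a `0` has been read, suffices for `truncate`. The sequential
-- transducer and the machine share this computation.
open Classical in
theorem truncate_state_step (α : OmegaWord (Fin (m + 1))) (n : ℕ) :
    (if decide (∃ j < n, α j = 0) = true ∨ α n = 0 then ((true, [0]) : Bool × List (Fin (m + 1)))
      else (false, [α n])) = (decide (∃ j < n + 1, α j = 0), [truncate α n]) := by
  have h : (∃ j < n + 1, α j = 0) ↔ ((∃ j < n, α j = 0) ∨ α n = 0) := by
    constructor
    · rintro ⟨j, hj, h⟩
      rcases (Nat.lt_succ_iff.1 hj).lt_or_eq with hlt | rfl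
      · exact Or.inl ⟨j, hlt, h⟩
      · exact Or.inr h
    · rintro (⟨j, hj, h⟩ | h)
      · exact ⟨j, by omega, h⟩
      · exact ⟨n, by omega, h⟩
  have h' : (∃ j ≤ n, α j = 0) ↔ ((∃ j < n, α j = 0) ∨ α n = 0) := by
    rw [← h]; simp
  unfold truncate
  simp only [decide_eq_true_eq, h, h']
  split_ifs with hc <;> simp [hc]

theorem concatEq_singleton {B : Type} (β : OmegaWord B) : ConcatEq (fun j => [β j]) β := by
  rw [concatEq_iff _ (fun t => t) rfl (by simp)]
  exact ⟨by simp, fun N => ⟨N, le_rfl⟩⟩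

theorem ConcatEq.eq {B : Type} {u : ℕ → List B} {β γ : OmegaWord B} (h : ConcatEq u β)
    (h' : ConcatEq u γ) : β = γ := by
  funext n
  obtain ⟨t, ht⟩ := h.2 (n + 1)
  rw [← h.1 t n ht, ← h'.1 t n ht]

open Classical in
theorem isLetterToLetterSequentialFun_truncateFun :
    IsLetterToLetterSequentialFun (truncateFun m) := by
  let S : SeqTransducer Bool (Fin (m + 1)) (Fin (m + 1)) :=
    { start := false
      step := fun q a => some (if q = true ∨ a = 0 then (true, [0]) else (false, [a]))
      prio := fun _ => 0 }
  have hS : ∀ α, ∀ (q : ℕ → Bool) v, q 0 = S.start →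
      (∀ i, S.step (q i) (α i) = some (q (i + 1), v i)) → v = fun i => [truncate α i] := by
    intro α q v h0 hq
    have hstate : ∀ i, q i = decide (∃ j < i, α j = 0) := by
      intro i
      induction i with
      | zero => simpa using h0
      | succ i ih =>
        have := Option.some.inj (hq i)
        rw [ih, truncate_state_step] at this
        exact (congrArg Prod.fst this).symm
    funext i
    have := Option.some.inj (hq i)
    rw [hstate i, truncate_state_step] at this
    exact (congrArg Prod.snd this).symm
  refine ⟨Bool, inferInstance, S, ?_, fun α β => ?_⟩
  · intro q a q' v h
    have h' := congrArg Prod.snd (Option.some.inj h)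
    dsimp only at h'
    rw [← h']
    split_ifs <;> rfl
  · rw [truncateFun, Part.mem_some_iff]
    constructor
    · rintro rfl
      refine ⟨fun i => decide (∃ j < i, α j = 0), fun i => [truncate α i], by simp [S],
        fun i => congrArg some (truncate_state_step α i), concatEq_singleton _, 0, by decide, ?_, ?_⟩
      · exact Frequently.of_forall fun _ => rfl
      · exact Eventually.of_forall fun _ => le_rfl
    · rintro ⟨q, v, h0, hq, hv, -⟩
      rw [hS α q v h0 hq] at hv
      exact hv.eq (concatEq_singleton _)

open Classical in
theorem isComputableFun_truncateFun : IsComputableFun (truncateFun m) := by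
  let M : OmegaMachine (Fin (m + 1)) (Fin (m + 1)) :=
    { State := Bool
      Sym := Unit
      start := false
      step := fun q a _ => some
        ((if q = true ∨ a = 0 then (true, [0]) else (false, [a]) : Bool × List (Fin (m + 1))).1,
          (), Turing.Dir.right, true,
          (if q = true ∨ a = 0 then (true, [0]) else (false, [a]) :
            Bool × List (Fin (m + 1))).2.head?) }
  refine ⟨M, fun α β hβ => ?_⟩
  obtain rfl := Part.mem_some_iff.1 hβ
  have hrun : ∀ t, (M.run α t).state = decide (∃ j < t, α j = 0) ∧ (M.run α t).pos = t ∧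
      (M.run α t).out = (List.range t).flatMap fun j => [truncate α j] := by
    intro t
    induction t with
    | zero => simp [OmegaMachine.run, M]
    | succ t ih =>
      obtain ⟨h1, h2, h3⟩ := ih
      have h := truncate_state_step α t
      rw [← h1] at h
      simp only [OmegaMachine.run, OmegaMachine.next, M] at h h1 h2 h3 ⊢
      rw [h2, h3, h, List.range_succ, List.flatMap_append]
      simp
  have hc := concatEq_singleton (truncate α)
  refine ⟨fun t => ?_, fun i => ?_⟩
  · rw [(hrun t).2.2]; exact hc.1 t
  · obtain ⟨t, ht⟩ := hc.2 i
    exact ⟨t, by rw [(hrun t).2.2]; exact ht⟩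

end Truncate

/-! ## Checking traces of a locally defined row system -/

/-- Data for words that consist of rows of equal length, separated by `sep`: each letter is
determined by the three letters around the corresponding position of the preceding row. The
first row consists of `head`, `first` and a number of letters `tail`, surrounded by blanks.
The letter `0` is the end marker. -/
structure RowSystem (m : ℕ) where
  sep : Fin (m + 1)
  blank : Fin (m + 1)
  head : Fin (m + 1)
  first : Fin (m + 1)
  tail : Fin (m + 1)
  rule : Fin (m + 1) → Fin (m + 1) → Fin (m + 1) → Fin (m + 1)
  halting : Fin (m + 1) → Prop
  sep_ne_zero : sep ≠ 0
  blank_ne_zero : blank ≠ 0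
  head_ne_zero : head ≠ 0
  first_ne_zero : first ≠ 0
  tail_ne_zero : tail ≠ 0
  blank_ne_sep : blank ≠ sep
  head_ne_sep : head ≠ sep
  first_ne_sep : first ≠ sep
  tail_ne_sep : tail ≠ sep
  head_ne_blank : head ≠ blank

/-- The states of the transducer that checks traces. -/
inductive CheckState
  | start | copy | pad | row0 | row1 | row2 | row3 | noHalt | shift0 | shift1 | scan
  | skip | skipEnd | acc

namespace RowSystem

open CheckState

variable {m : ℕ} (D : RowSystem m)

/-- The word `α` begins with an initial row of length `P`, in which `p` blanks and `n` letters
`tail` surround `head` and `first`, and the next separator. -/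
structure IsFirstRow (n : ℕ) (α : OmegaWord (Fin (m + 1))) (p P : ℕ) : Prop where
  sep_zero : α 0 = D.sep
  blank_left : ∀ j, 1 ≤ j → j ≤ p → α j = D.blank
  head_eq : α (p + 1) = D.head
  first_eq : α (p + 2) = D.first
  tail_eq : ∀ j < n, α (p + 3 + j) = D.tail
  le_length : p + 3 + n ≤ P
  blank_right : ∀ j, p + 3 + n ≤ j → j < P → α j = D.blank
  sep_length : α P = D.sep

/-- The first `e` letters of `α` form a trace that contains a halting letter and begins with an
initial row. -/
structure IsTrace (n : ℕ) (α : OmegaWord (Fin (m + 1))) (e p P : ℕ) : Prop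
    extends D.IsFirstRow n α p P where
  ne_zero : ∀ j < e, α j ≠ 0
  end_zero : α e = 0
  length_lt : P < e
  rule_eq : ∀ j, j + 1 + P < e → α (j + 1 + P) = D.rule (α j) (α (j + 1)) (α (j + 2))
  halts : ∃ h < e, D.halting (α h)

/-- The state that waits for the end marker followed by another letter, when `a` was read. -/
def skipAfter (a : Fin (m + 1)) : CheckState := if a = 0 then skipEnd else skip

/-- The transitions of the checking transducer that do not depend on the first row. -/
inductive FixedTrans : CheckState → List (Fin (m + 1)) → List (Fin (m + 1)) → CheckState → Prop
  | start_copy : FixedTrans start [] [] copy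
  | start_row : FixedTrans start [] [] row0
  | start_noHalt : FixedTrans start [] [] noHalt
  | start_shift : FixedTrans start [] [] shift0
  -- Serves to make the domain total: an output beginning with `0` is a defect in itself.
  | start_end (a) (ha : a ≠ 0) : FixedTrans start [a] [0] skip
  | copy (a) (ha : a ≠ 0) : FixedTrans copy [a] [a] copy
  | copy_pad : FixedTrans copy [0] [0] pad
  | pad : FixedTrans pad [0] [0] pad
  | row0_sep : FixedTrans row0 [D.sep] [] row1
  | row0_bad (a) (ha : a ≠ D.sep) : FixedTrans row0 [a] [] (skipAfter a)
  | row1_blank : FixedTrans row1 [D.blank] [] row1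
  | row1_bad (a) (ha : a ≠ D.blank) (ha' : a ≠ D.head) : FixedTrans row1 [a] [] (skipAfter a)
  | row1_first_bad (a) (ha : a ≠ D.first) : FixedTrans row1 [D.head, a] [] (skipAfter a)
  | row2_bad (a) (ha : a ≠ D.tail) : FixedTrans row2 [a] [] (skipAfter a)
  | row3_blank : FixedTrans row3 [D.blank] [] row3
  | row3_bad (a) (ha : a ≠ D.blank) (ha' : a ≠ D.sep) : FixedTrans row3 [a] [] (skipAfter a)
  | noHalt (a) (ha : a ≠ 0) (ha' : ¬ D.halting a) : FixedTrans noHalt [a] [] noHalt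
  | noHalt_end : FixedTrans noHalt [0] [] skipEnd
  -- The output head passes the second separator of the output while the input head waits at
  -- position 0.
  | shift_start : FixedTrans shift0 [] [D.sep] shift1
  | shift (a) (ha : a ≠ D.sep) : FixedTrans shift1 [] [a] shift1
  | shift_scan : FixedTrans shift1 [] [D.sep] scan
  | scan (a b) (ha : a ≠ 0) (hb : b ≠ 0) : FixedTrans scan [a] [b] scan
  -- In `scan` the output head is one row length plus one ahead, so `d` stands directly below `b`.
  | scan_bad (a b c d) (ha : a ≠ 0) (hb : b ≠ 0) (hc : c ≠ 0) (hd : d ≠ 0)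
      (h : d ≠ D.rule a b c) : FixedTrans scan [a, b, c] [d] skip
  | skip (a) (ha : a ≠ 0) : FixedTrans skip [a] [] skip
  | skip_end : FixedTrans skip [0] [] skipEnd
  | skipEnd_zero : FixedTrans skipEnd [0] [] skipEnd
  | skipEnd_acc (a) (ha : a ≠ 0) : FixedTrans skipEnd [a] [] acc
  | acc (a b) : FixedTrans acc [a] [b] acc

/-- The transitions of the checking transducer. -/
inductive Trans (n : ℕ) :
    CheckState → List (Fin (m + 1)) → List (Fin (m + 1)) → CheckState → Prop
  | fixed {q u v q'} (h : D.FixedTrans q u v q') : Trans n q u v q'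
  -- The number `n` affects only labels and the number of transitions, not the states. `short i`
  -- followed by `row2_bad` detects a wrong letter after `i` letters `tail`.
  | short (i) (hi : i < n) : Trans n row1 (D.head :: D.first :: List.replicate i D.tail) [] row2
  | full : Trans n row1 (D.head :: D.first :: List.replicate n D.tail) [] row3

/-- The accepting states of the checking transducer. -/
def Acc (q : CheckState) : Prop := q = .copy ∨ q = .pad ∨ q = .acc

/-! ### Limits on accepted pairs -/

variable {D} {n : ℕ} {α β : OmegaWord (Fin (m + 1))}

theorem IsFirstRow.ne_sep {p P : ℕ} (hα : D.IsFirstRow n α p P) (j : ℕ) (hj : 1 ≤ j) (hjP : j < P) :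
    α j ≠ D.sep := by
  by_cases h1 : j ≤ p
  · rw [hα.blank_left j hj h1]; exact D.blank_ne_sep
  by_cases h2 : j = p + 1
  · rw [h2, hα.head_eq]; exact D.head_ne_sep
  by_cases h3 : j = p + 2
  · rw [h3, hα.first_eq]; exact D.first_ne_sep
  by_cases h4 : j < p + 3 + n
  · rw [show j = p + 3 + (j - (p + 3)) by omega, hα.tail_eq _ (by omega)]
    exact D.tail_ne_sep
  · rw [hα.blank_right j (by omega) hjP]; exact D.blank_ne_sep

/-- The words that are paired with a word that ends in zeros are copies. -/
theorem eq_of_accFrom (hα : ∀ i j, i ≤ j → α i = 0 → α j = 0)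
    (h : AccFrom (D.Trans n) Acc α β (start, 0, 0)) : β = α := by
  -- In `skipEnd` a zero has been passed, so moving on to `acc` would require a nonzero letter after
  -- a zero. The other states with trivial invariant are not accepting.
  have key := h.exists_invariant
    (fun q i k => match q with
      | .start => i = 0 ∧ k = 0
      | .copy => k = i ∧ ∀ j < i, β j = α j
      | .pad => k = i ∧ ∀ j < i, β j = α j
      | .skipEnd => ∃ z < i, α z = 0
      | .acc => False
      | _ => True) ⟨rfl, rfl⟩ ?_
  · funext j
    obtain ⟨q, i, k, hJ, hq, hi⟩ := key (j + 1)
    rcases hq with rfl | rfl | rfl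
    · exact hJ.2 j hi
    · exact hJ.2 j hi
    · exact hJ.elim
  · have hext : ∀ i a, α i = a → β i = a → (∀ j < i, β j = α j) → ∀ j < i + 1, β j = α j := by
      intro i a h1 h2 h3 j hj
      rcases (Nat.lt_succ_iff.1 hj).lt_or_eq with hlt | rfl
      · exact h3 j hlt
      · rw [h1, h2]
    have hskip : ∀ i a, α i = a → ∀ j, i < j → ∀ k : ℕ, (match skipAfter a with
      | .start => j = 0 ∧ k = 0
      | .copy => k = j ∧ ∀ l < j, β l = α l
      | .pad => k = j ∧ ∀ l < j, β l = α l
      | .skipEnd => ∃ z < j, α z = 0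
      | .acc => False
      | _ => True) := by
      intro i a ha j hj k
      unfold skipAfter
      split_ifs with h0
      · exact ⟨i, hj, by rw [ha, h0]⟩
      · trivial
    rintro q i k u v q' hJ (⟨hT⟩ | ⟨j, hj⟩ | _) hu hv
    · cases hT <;> simp only [matchAt_cons, matchAt_nil, and_true, List.length_cons,
        List.length_nil, zero_add, add_zero] at hJ hu hv ⊢
      case start_copy => exact ⟨by omega, fun j hj => by omega⟩
      case copy a ha => obtain ⟨rfl, hJ⟩ := hJ; exact ⟨rfl, hext _ _ hu hv hJ⟩
      case copy_pad => obtain ⟨rfl, hJ⟩ := hJ; exact ⟨rfl, hext _ _ hu hv hJ⟩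
      case pad => obtain ⟨rfl, hJ⟩ := hJ; exact ⟨rfl, hext _ _ hu hv hJ⟩
      case row0_bad a ha => exact hskip i a hu _ (by omega) _
      case row1_bad a ha ha' => exact hskip i a hu _ (by omega) _
      case row1_first_bad a ha => exact hskip (i + 1) a hu.2 _ (by omega) _
      case row2_bad a ha => exact hskip i a hu _ (by omega) _
      case row3_bad a ha ha' => exact hskip i a hu _ (by omega) _
      case noHalt_end => exact ⟨i, by omega, hu⟩
      case skip_end => exact ⟨i, by omega, hu⟩
      case skipEnd_zero => exact ⟨i, by omega, hu⟩
      case skipEnd_acc a ha =>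
        obtain ⟨z, hz, h0⟩ := hJ
        exact ha (by rw [← hu, hα z i hz.le h0])
    · trivial
    · trivial

/-- A trace that is followed by a zero and later by another letter is not paired with words that
begin with this trace and a zero. -/
theorem IsTrace.not_accFrom {e p P g : ℕ} (hα : D.IsTrace n α e p P) (heg : e < g)
    (hg : α g ≠ 0) (hβ : ∀ j ≤ e, β j = α j) :
    ¬ AccFrom (D.Trans n) Acc α β (start, 0, 0) := by
  intro h
  obtain ⟨hh, hhe, hhalt⟩ := hα.halts
  have hP := hα.length_lt
  have hpP := hα.le_length
  have hne : ∀ i, i ≤ e → α i ≠ 0 → i + 1 ≤ e := by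
    intro i hi h0
    rcases hi.lt_or_eq with hlt | rfl
    · exact hlt
    · exact absurd hα.end_zero h0
  -- Each state is confined to positions where its test can still be running; as a trace has no
  -- defect, the error transitions are never enabled. `copy` cannot pass the end marker and `pad`
  -- cannot pass the nonzero letter at `g`, hence no accepting state occurs with the input head
  -- beyond `g`.
  have key := h.exists_invariant
    (fun q i k => match q with
      | .start => i = 0 ∧ k = 0
      | .copy => i ≤ e
      | .pad => i ≤ g
      | .row0 => i = 0
      | .row1 => 1 ≤ i ∧ i ≤ p + 1
      | .row2 => p + 3 ≤ i ∧ i < p + 3 + n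
      | .row3 => p + 3 + n ≤ i ∧ i ≤ P
      | .noHalt => i ≤ hh
      | .shift0 => i = 0 ∧ k = 0
      | .shift1 => i = 0 ∧ 1 ≤ k ∧ k ≤ P
      | .scan => k = i + P + 1 ∧ k ≤ e
      | _ => False) ⟨rfl, rfl⟩ ?_
  · obtain ⟨q, i, k, hJ, hq, hi⟩ := key (g + 1)
    rcases hq with rfl | rfl | rfl
    · simp only at hJ; omega
    · simp only at hJ; omega
    · exact hJ.elim
  · rintro q i k u v q' hJ (⟨hT⟩ | ⟨j, hj⟩ | _) hu hv
    · cases hT <;> simp only [matchAt_cons, matchAt_nil, and_true, List.length_cons,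
        List.length_nil, zero_add, add_zero] at hJ hu hv ⊢
      case start_copy => omega
      case start_row => omega
      case start_noHalt => omega
      case start_shift => exact hJ
      case start_end a ha =>
        obtain ⟨rfl, rfl⟩ := hJ
        rw [hβ 0 (by omega), hα.sep_zero] at hv
        exact D.sep_ne_zero hv
      case copy a ha => exact hne i hJ (hu ▸ ha)
      case copy_pad => omega
      case pad =>
        rcases hJ.lt_or_eq with hlt | rfl
        · exact hlt
        · exact absurd hu hg
      case row0_sep => omega
      case row0_bad a ha => exact absurd (hα.sep_zero) (by rw [← hJ, hu]; exact ha)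
      case row1_blank =>
        refine ⟨by omega, ?_⟩
        rcases hJ.2.lt_or_eq with hlt | rfl
        · omega
        · rw [hα.head_eq] at hu; exact absurd hu D.head_ne_blank
      case row1_bad a ha ha' =>
        rcases hJ.2.lt_or_eq with hlt | rfl
        · exact absurd (hα.blank_left i hJ.1 (by omega)) (hu ▸ ha)
        · exact absurd hα.head_eq (hu ▸ ha')
      case row1_first_bad a ha =>
        rcases hJ.2.lt_or_eq with hlt | rfl
        · exact absurd ((hα.blank_left i hJ.1 (by omega)).symm.trans hu.1) D.head_ne_blank.symm
        · exact absurd hα.first_eq (hu.2 ▸ ha)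
      case row2_bad a ha =>
        have := hα.tail_eq (i - (p + 3)) (by omega)
        rw [show p + 3 + (i - (p + 3)) = i by omega] at this
        exact absurd this (hu ▸ ha)
      case row3_blank =>
        refine ⟨by omega, ?_⟩
        rcases hJ.2.lt_or_eq with hlt | rfl
        · omega
        · rw [hα.sep_length] at hu; exact absurd hu D.blank_ne_sep.symm
      case row3_bad a ha ha' =>
        rcases hJ.2.lt_or_eq with hlt | rfl
        · exact absurd (hα.blank_right i hJ.1 hlt) (hu ▸ ha)
        · exact absurd hα.sep_length (hu ▸ ha')
      case noHalt a ha ha' =>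
        rcases hJ.lt_or_eq with hlt | rfl
        · exact hlt
        · exact absurd hhalt (hu ▸ ha')
      case noHalt_end => exact absurd hu (hα.ne_zero i (by omega))
      case shift_start => omega
      case shift a ha =>
        refine ⟨hJ.1, by omega, ?_⟩
        rcases hJ.2.2.lt_or_eq with hlt | rfl
        · exact hlt
        · rw [hβ k (by omega), hα.sep_length] at hv; exact absurd hv.symm ha
      case shift_scan =>
        -- The first row has no inner separator, so the separator guessed to be the second one is at
        -- `P`.
        have hk : k = P := by
          by_contra hk
          rw [hβ k (by omega)] at hv
          exact hα.ne_sep k hJ.2.1 (by omega) hv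
        omega
      case scan a b ha hb =>
        refine ⟨by omega, hne k hJ.2 ?_⟩
        rw [← hβ k hJ.2, hv]; exact hb
      case scan_bad a b c d ha hb hc hd hr =>
        rw [hβ k hJ.2] at hv
        have hk := hne k hJ.2 (hv ▸ hd)
        have := hα.rule_eq i (by omega)
        rw [show i + 1 + P = k by omega, hv, hu.1, hu.2.1, hu.2.2] at this
        exact hr this
    · simp only [matchAt_cons, matchAt_replicate, List.length_cons, List.length_replicate]
        at hJ hu ⊢
      have hi : i = p + 1 := by
        by_contra hi
        rw [hα.blank_left i hJ.1 (by omega)] at hu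
        exact D.head_ne_blank hu.1.symm
      omega
    · simp only [matchAt_cons, matchAt_replicate, List.length_cons, List.length_replicate]
        at hJ hu ⊢
      have hi : i = p + 1 := by
        by_contra hi
        rw [hα.blank_left i hJ.1 (by omega)] at hu
        exact D.head_ne_blank hu.1.symm
      omega

/-! ### Existence of runs -/

theorem Trans.step {q q' : CheckState} {u v : List (Fin (m + 1))} (h : D.Trans n q u v q')
    {i k i' k' : ℕ} (hu : MatchAt α i u) (hv : MatchAt β k v) (hi : i' = i + u.length)
    (hk : k' = k + v.length) : Step (D.Trans n) α β (q, i, k) (q', i', k') :=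
  ⟨u, v, h, hu, hv, hi, hk⟩

theorem FixedTrans.accFrom {q q' : CheckState} {u v : List (Fin (m + 1))}
    (h : D.FixedTrans q u v q') {i k i' k' : ℕ} (hu : MatchAt α i u) (hv : MatchAt β k v)
    (hi : i' = i + u.length) (hk : k' = k + v.length)
    (ha : AccFrom (D.Trans n) Acc α β (q', i', k')) : AccFrom (D.Trans n) Acc α β (q, i, k) :=
  ha.of_step ((Trans.fixed h).step hu hv hi hk)

theorem accFrom_acc (i k : ℕ) : AccFrom (D.Trans n) Acc α β (acc, i, k) := by
  refine ⟨fun t => (acc, i + t, k + t), rfl, fun t => ?_, fun N => ⟨N, by simp⟩,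
    fun N => ⟨N, by simp⟩, Frequently.of_forall fun _ => Or.inr (Or.inr rfl)⟩
  exact (Trans.fixed (.acc (α (i + t)) (β (k + t)))).step (by simp) (by simp) rfl rfl

theorem accFrom_skipEnd {i g : ℕ} (k : ℕ) (hig : i ≤ g) (hg : α g ≠ 0) :
    AccFrom (D.Trans n) Acc α β (skipEnd, i, k) := by
  induction hig using Nat.decreasingInduction with
  | self =>
    exact (FixedTrans.skipEnd_acc _ hg).accFrom (i' := g + 1) (k' := k) (by simp) (by simp) rfl rfl
      (accFrom_acc _ _)
  | of_succ i hi ih =>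
    by_cases h0 : α i = 0
    · exact FixedTrans.skipEnd_zero.accFrom (by simp [h0]) (by simp) rfl rfl ih
    · exact (FixedTrans.skipEnd_acc _ h0).accFrom (by simp) (by simp) rfl rfl (accFrom_acc _ _)

theorem accFrom_skip {i e g : ℕ} (k : ℕ) (hie : i ≤ e) (he : α e = 0) (heg : e < g)
    (hg : α g ≠ 0) : AccFrom (D.Trans n) Acc α β (skip, i, k) := by
  induction hie using Nat.decreasingInduction with
  | self =>
    exact FixedTrans.skip_end.accFrom (i' := e + 1) (k' := k) (by simp [he]) (by simp) rfl
      rfl (accFrom_skipEnd _ heg hg)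
  | of_succ i hi ih =>
    by_cases h0 : α i = 0
    · exact FixedTrans.skip_end.accFrom (i' := i + 1) (k' := k) (by simp [h0]) (by simp) rfl rfl
        (accFrom_skipEnd _ (by omega) hg)
    · exact (FixedTrans.skip _ h0).accFrom (by simp) (by simp) rfl rfl ih

theorem accFrom_skipAfter {i e g : ℕ} (k : ℕ) (hie : i ≤ e) (he : α e = 0) (heg : e < g)
    (hg : α g ≠ 0) : AccFrom (D.Trans n) Acc α β (skipAfter (α i), i + 1, k) := by
  unfold skipAfter
  split_ifs with h0
  · exact accFrom_skipEnd _ (by omega) hg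
  · refine accFrom_skip _ ?_ he heg hg
    rcases hie.lt_or_eq with hlt | rfl
    · exact hlt
    · exact absurd he h0

theorem accFrom_copy (hα : ∀ i j, i ≤ j → α i = 0 → α j = 0) :
    AccFrom (D.Trans n) Acc α α (start, 0, 0) := by
  classical
  refine FixedTrans.start_copy.accFrom (i' := 0) (k' := 0) (by simp) (by simp) rfl rfl ?_
  refine ⟨fun t => (if ∃ j < t, α j = 0 then pad else copy, t, t), by simp, fun t => ?_,
    fun N => ⟨N, le_rfl⟩, fun N => ⟨N, le_rfl⟩, Frequently.of_forall fun t => ?_⟩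
  · dsimp only
    by_cases h : ∃ j < t, α j = 0
    · obtain ⟨j, hj, h0⟩ := h
      have ht := hα j t hj.le h0
      rw [if_pos ⟨j, hj, h0⟩, if_pos ⟨j, by omega, h0⟩]
      exact (Trans.fixed .pad).step (by simp [ht]) (by simp [ht]) rfl rfl
    · rw [if_neg h]
      by_cases h0 : α t = 0
      · rw [if_pos ⟨t, by omega, h0⟩]
        exact (Trans.fixed .copy_pad).step (by simp [h0]) (by simp [h0]) rfl rfl
      · rw [if_neg]
        · exact (Trans.fixed (.copy _ h0)).step (by simp) (by simp) rfl rfl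
        · rintro ⟨j, hj, h1⟩
          rcases (Nat.lt_succ_iff.1 hj).lt_or_eq with hlt | rfl
          · exact h ⟨j, hlt, h1⟩
          · exact h0 h1
  · dsimp only [Acc]
    split_ifs <;> simp

/-- If a nonzero letter follows a zero, the zero word is a valid output: either the first letter is
nonzero and `start_end` applies, or it is `0` and the first separator is missing. -/
theorem exists_accFrom (D : RowSystem m) (n : ℕ) (α : OmegaWord (Fin (m + 1))) :
    ∃ β, AccFrom (D.Trans n) Acc α β (start, 0, 0) := by
  by_cases hα : ∀ i j, i ≤ j → α i = 0 → α j = 0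
  · exact ⟨α, accFrom_copy hα⟩
  push Not at hα
  obtain ⟨e, g, heg, he, hg⟩ := hα
  have heg' : e < g := lt_of_le_of_ne heg fun h => hg (h ▸ he)
  refine ⟨fun _ => 0, ?_⟩
  by_cases h0 : α 0 = 0
  · refine FixedTrans.start_row.accFrom (i' := 0) (k' := 0) (by simp) (by simp) rfl rfl ?_
    refine (FixedTrans.row0_bad 0 D.sep_ne_zero.symm).accFrom (by simp [h0]) (by simp) rfl rfl ?_
    have := accFrom_skipAfter (D := D) (n := n) (β := fun _ => 0) 0 (Nat.zero_le e) he heg' hg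
    rwa [h0] at this
  · refine (FixedTrans.start_end _ h0).accFrom (by simp) (by simp) rfl rfl ?_
    refine accFrom_skip _ ?_ he heg' hg
    rcases Nat.eq_zero_or_pos e with rfl | hpos
    · exact absurd he h0
    · exact hpos

/-- If the letters before the first zero do not form a trace, then the word is paired with every
word that begins with the same letters and this zero. -/
theorem accFrom_of_not_isTrace {e g : ℕ} (hne : ∀ j < e, α j ≠ 0) (he : α e = 0) (heg : e < g)
    (hg : α g ≠ 0) (hβ : ∀ j ≤ e, β j = α j) (hT : ∀ p P, ¬ D.IsTrace n α e p P) :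
    AccFrom (D.Trans n) Acc α β (start, 0, 0) := by
  -- Without an accepting run, every configuration reached by a successful part of a check is
  -- rejecting. Hence no error transition applies there, and each check yields one clause of
  -- `IsTrace`.
  by_contra hno
  have hskip : ∀ i k, i ≤ e → AccFrom (D.Trans n) Acc α β (skipAfter (α i), i + 1, k) :=
    fun i k hi => accFrom_skipAfter k hi he heg hg
  have hnext : ∀ i, i ≤ e → α i ≠ 0 → i + 1 ≤ e := by
    intro i hi h0
    rcases hi.lt_or_eq with hlt | rfl
    · exact hlt
    · exact absurd he h0
  have hrow0 : ¬ AccFrom (D.Trans n) Acc α β (row0, 0, 0) := fun h =>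
    hno (FixedTrans.start_row.accFrom (by simp) (by simp) rfl rfl h)
  have hsep : α 0 = D.sep := by
    by_contra hs
    exact hrow0 ((FixedTrans.row0_bad _ hs).accFrom (by simp) (by simp) rfl rfl
      (hskip 0 0 (by omega)))
  have hrow1 : ¬ AccFrom (D.Trans n) Acc α β (row1, 1, 0) := fun h =>
    hrow0 (FixedTrans.row0_sep.accFrom (by simp [hsep]) (by simp) rfl rfl h)
  have he1 : 1 ≤ e := hnext 0 (by omega) (hsep ▸ D.sep_ne_zero)
  -- The end marker is not blank, so the block of blanks stops at the latest at `e`.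
  have hblank : ∃ j, α (j + 1) ≠ D.blank :=
    ⟨e - 1, by rw [Nat.sub_add_cancel he1, he]; exact D.blank_ne_zero.symm⟩
  classical
  obtain ⟨p, hp, hpmin⟩ : ∃ p, α (p + 1) ≠ D.blank ∧ ∀ j < p, α (j + 1) = D.blank :=
    ⟨Nat.find hblank, Nat.find_spec hblank, fun j hj => not_not.1 (Nat.find_min hblank hj)⟩
  have hreach1 : ∀ j ≤ p, j + 1 ≤ e ∧ ¬ AccFrom (D.Trans n) Acc α β (row1, j + 1, 0) := by
    intro j hj
    induction j with
    | zero => exact ⟨he1, hrow1⟩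
    | succ j ih =>
      obtain ⟨h1, h2⟩ := ih (by omega)
      have hb := hpmin j (by omega)
      exact ⟨hnext _ h1 (hb ▸ D.blank_ne_zero),
        fun h => h2 (FixedTrans.row1_blank.accFrom (by simp [hb]) (by simp) rfl rfl h)⟩
  obtain ⟨hpe, hrow1p⟩ := hreach1 p le_rfl
  have hhead : α (p + 1) = D.head := by
    by_contra hh
    exact hrow1p ((FixedTrans.row1_bad _ hp hh).accFrom (by simp) (by simp) rfl rfl
      (hskip _ _ hpe))
  have hp2 := hnext _ hpe (hhead ▸ D.head_ne_zero)
  have hfirst : α (p + 2) = D.first := by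
    by_contra hf
    exact hrow1p ((FixedTrans.row1_first_bad _ hf).accFrom (by simp [hhead]) (by simp) rfl rfl
      (hskip _ _ hp2))
  have hp3 := hnext _ hp2 (hfirst ▸ D.first_ne_zero)
  have htail : ∀ i ≤ n, (∀ j < i, α (p + 3 + j) = D.tail) ∧ p + 3 + i ≤ e := by
    intro i hi
    induction i with
    | zero => exact ⟨by omega, hp3⟩
    | succ i ih =>
      obtain ⟨h1, h2⟩ := ih (by omega)
      have h3 : α (p + 3 + i) = D.tail := by
        by_contra ht
        refine hrow1p (AccFrom.of_step (c' := (row2, p + 3 + i, 0))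
          ((Trans.short i (by omega)).step ?_ (by simp) ?_ (by simp)) ?_)
        · simpa [matchAt_replicate, hhead, hfirst] using h1
        · simp only [List.length_cons, List.length_replicate]; omega
        · exact (FixedTrans.row2_bad _ ht).accFrom (by simp) (by simp) rfl rfl (hskip _ _ h2)
      refine ⟨fun j hj => ?_, hnext _ h2 (h3 ▸ D.tail_ne_zero)⟩
      rcases (Nat.lt_succ_iff.1 hj).lt_or_eq with hlt | rfl
      · exact h1 j hlt
      · exact h3
  obtain ⟨htail, hpn⟩ := htail n le_rfl
  have hrow3 : ¬ AccFrom (D.Trans n) Acc α β (row3, p + 3 + n, 0) := by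
    refine fun h => hrow1p (AccFrom.of_step (Trans.full.step ?_ (by simp) ?_ (by simp)) h)
    · simpa [matchAt_replicate, hhead, hfirst] using htail
    · simp only [List.length_cons, List.length_replicate]; omega
  have hblank' : ∃ j, α (p + 3 + n + j) ≠ D.blank :=
    ⟨e - (p + 3 + n), by rw [Nat.add_sub_cancel' hpn, he]; exact D.blank_ne_zero.symm⟩
  obtain ⟨s, hs, hsmin⟩ : ∃ s, α (p + 3 + n + s) ≠ D.blank ∧
      ∀ j < s, α (p + 3 + n + j) = D.blank :=
    ⟨Nat.find hblank', Nat.find_spec hblank', fun j hj => not_not.1 (Nat.find_min hblank' hj)⟩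
  have hreach3 : ∀ j ≤ s, p + 3 + n + j ≤ e ∧
      ¬ AccFrom (D.Trans n) Acc α β (row3, p + 3 + n + j, 0) := by
    intro j hj
    induction j with
    | zero => exact ⟨hpn, hrow3⟩
    | succ j ih =>
      obtain ⟨h1, h2⟩ := ih (by omega)
      have hb := hsmin j (by omega)
      exact ⟨hnext _ h1 (hb ▸ D.blank_ne_zero),
        fun h => h2 (FixedTrans.row3_blank.accFrom (by simp [hb]) (by simp) rfl rfl h)⟩
  obtain ⟨hPe, hrow3P⟩ := hreach3 s le_rfl
  obtain ⟨P, hP⟩ : ∃ P, P = p + 3 + n + s := ⟨_, rfl⟩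
  rw [← hP] at hs hPe hrow3P
  have hsepP : α P = D.sep := by
    by_contra h
    exact hrow3P ((FixedTrans.row3_bad _ hs h).accFrom (by simp) (by simp) rfl rfl
      (hskip _ _ hPe))
  have hPlt := hnext _ hPe (hsepP ▸ D.sep_ne_zero)
  have hrow : D.IsFirstRow n α p P :=
    { sep_zero := hsep
      blank_left := fun j h1 h2 => by
        simpa [Nat.sub_add_cancel h1] using hpmin (j - 1) (by omega)
      head_eq := hhead
      first_eq := hfirst
      tail_eq := htail
      le_length := by omega
      blank_right := fun j h1 h2 => by
        simpa [Nat.add_sub_cancel' h1] using hsmin (j - (p + 3 + n)) (by omega)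
      sep_length := hsepP }
  -- From here on the separators and row contents are read in `β`, which agrees with `α` up to `e`.
  have hshift : ∀ k, k + 1 ≤ P → ¬ AccFrom (D.Trans n) Acc α β (shift1, 0, k + 1) := by
    intro k hk
    induction k with
    | zero =>
      refine fun h => hno (FixedTrans.start_shift.accFrom (i' := 0) (k' := 0) (by simp) (by simp)
        rfl rfl (FixedTrans.shift_start.accFrom (by simp) ?_ rfl rfl h))
      simp [hβ 0 (by omega), hsep]
    | succ k ih =>
      refine fun h => ih (by omega) ((FixedTrans.shift (α (k + 1))
        (hrow.ne_sep _ (by omega) (by omega))).accFrom (by simp) ?_ rfl rfl h)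
      simp [hβ (k + 1) (by omega)]
  have hscan : ∀ j, j + 1 + P ≤ e → ¬ AccFrom (D.Trans n) Acc α β (scan, j, j + 1 + P) := by
    intro j hj
    induction j with
    | zero =>
      have h1 := hshift (P - 1) (by omega)
      rw [Nat.sub_add_cancel (by omega)] at h1
      refine fun h => h1 (FixedTrans.shift_scan.accFrom (by simp) ?_ rfl
        (by simp only [List.length_singleton]; omega) h)
      simp [hβ P (by omega), hsepP]
    | succ j ih =>
      refine fun h => ih (by omega) ((FixedTrans.scan _ _ (hne j (by omega))
        (hne (j + 1 + P) (by omega))).accFrom (by simp) ?_ rfl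
        (by simp only [List.length_singleton]; omega) h)
      simp [hβ (j + 1 + P) (by omega)]
  refine hT p P { toIsFirstRow := hrow, ne_zero := hne, end_zero := he, length_lt := hPlt,
                   rule_eq := ?_, halts := ?_ }
  · intro j hj
    by_contra hr
    refine hscan j hj.le ((FixedTrans.scan_bad (α j) (α (j + 1)) (α (j + 2)) _ (hne _ (by omega))
      (hne _ (by omega)) (hne _ (by omega)) (hne _ hj) hr).accFrom (by simp) ?_ rfl rfl
      (accFrom_skip _ ?_ he heg hg))
    · simp [hβ (j + 1 + P) (by omega)]
    · simp only [List.length_cons, List.length_nil]; omega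
  · by_contra hh
    push Not at hh
    have hnoHalt : ∀ j ≤ e, ¬ AccFrom (D.Trans n) Acc α β (noHalt, j, 0) := by
      intro j hj
      induction j with
      | zero => exact fun h => hno (FixedTrans.start_noHalt.accFrom (by simp) (by simp) rfl rfl h)
      | succ j ih =>
        exact fun h => ih (by omega) ((FixedTrans.noHalt _ (hne j (by omega))
          (hh j (by omega))).accFrom (by simp) (by simp) rfl rfl h)
    exact hnoHalt e le_rfl (FixedTrans.noHalt_end.accFrom (by simp [he]) (by simp) rfl rfl
      (accFrom_skipEnd _ heg hg))

end RowSystem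

namespace RowSystem

variable {m : ℕ} (D : RowSystem m)

/-! ## The code of the checking transducer -/

/-- The states of the checking transducer, numbered. -/
def stateEquiv : CheckState ≃ Fin 14 where
  toFun
    | .start => 0 | .copy => 1 | .pad => 2 | .row0 => 3 | .row1 => 4 | .row2 => 5 | .row3 => 6
    | .noHalt => 7 | .shift0 => 8 | .shift1 => 9 | .scan => 10 | .skip => 11 | .skipEnd => 12
    | .acc => 13
  invFun := ![.start, .copy, .pad, .row0, .row1, .row2, .row3, .noHalt, .shift0, .shift1, .scan,
    .skip, .skipEnd, .acc]
  left_inv q := by cases q <;> rfl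
  right_inv i := by fin_cases i <;> rfl

theorem FixedTrans.length_le {q q' : CheckState} {u v : List (Fin (m + 1))}
    (h : D.FixedTrans q u v q') : u.length < 4 ∧ v.length < 4 := by
  cases h <;> simp

/-- There are finitely many states, and no label has more than three letters. -/
theorem finite_fixedTrans : {t : CheckState × List (Fin (m + 1)) × List (Fin (m + 1)) × CheckState |
    D.FixedTrans t.1 t.2.1 t.2.2.1 t.2.2.2}.Finite := by
  have : Finite CheckState := Finite.of_equiv _ stateEquiv.symm
  have hl := List.finite_length_lt (Fin (m + 1)) 4
  refine (Set.finite_univ.prod (hl.prod (hl.prod Set.finite_univ))).subset fun t ht => ?_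
  have := FixedTrans.length_le D ht
  exact ⟨trivial, this.1, this.2, trivial⟩

/-- The numerical description of a transition. -/
def encodeTrans (t : CheckState × List (Fin (m + 1)) × List (Fin (m + 1)) × CheckState) :
    ℕ × List ℕ × List ℕ × ℕ :=
  (stateEquiv t.1, t.2.1.map Fin.val, t.2.2.1.map Fin.val, stateEquiv t.2.2.2)

/-- A list of the transitions. -/
noncomputable def transList (n : ℕ) :
    List (CheckState × List (Fin (m + 1)) × List (Fin (m + 1)) × CheckState) :=
  D.finite_fixedTrans.toFinset.toList ++
    ((List.range n).map (fun i => (.row1, D.head :: D.first :: List.replicate i D.tail, [], .row2)) ++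
      [(.row1, D.head :: D.first :: List.replicate n D.tail, [], .row3)])

theorem mem_transList {n : ℕ} {q q' : CheckState} {u v : List (Fin (m + 1))} :
    (q, u, v, q') ∈ D.transList n ↔ D.Trans n q u v q' := by
  simp only [transList, List.mem_append, Finset.mem_toList, Set.Finite.mem_toFinset,
    Set.mem_ofPred_eq, List.mem_map, List.mem_range, Prod.mk.injEq, List.mem_singleton]
  constructor
  · rintro (h | ⟨i, hi, rfl, rfl, rfl, rfl⟩ | ⟨rfl, rfl, rfl, rfl⟩)
    · exact .fixed h
    · exact .short i hi
    · exact .full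
  · rintro (h | ⟨i, hi⟩ | _)
    · exact Or.inl h
    · exact Or.inr (Or.inl ⟨i, hi, rfl, rfl, rfl, rfl⟩)
    · exact Or.inr (Or.inr ⟨rfl, rfl, rfl, rfl⟩)

open Classical in
/-- The code of the checking transducer. -/
noncomputable def code (n : ℕ) : TransducerCode where
  stateMax := 13
  inMax := m
  outMax := m
  start := 0
  trans := (D.transList n).map encodeTrans
  prio := List.ofFn fun i => if Acc (stateEquiv.symm i) then 2 else 1

/-- The transducer described by the code. -/
noncomputable def transducer (n : ℕ) : ParityTransducer (Fin 14) (Fin (m + 1)) (Fin (m + 1)) :=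
  (D.code n).toTransducer

theorem mem_transducer_trans {n : ℕ} {q q' : CheckState} {u v : List (Fin (m + 1))} :
    (stateEquiv q, u, v, stateEquiv q') ∈ (D.transducer n).trans ↔ D.Trans n q u v q' := by
  have h : (D.transducer n).trans = ((D.transList n).map
      fun t => (stateEquiv t.1, t.2.1, t.2.2.1, stateEquiv t.2.2.2)).toFinset := by
    have hmap : ∀ u : List (Fin (m + 1)), (u.map Fin.val).map (Fin.ofNat (m + 1)) = u := fun u => by
      simp [Function.comp_def]
    refine congrArg List.toFinset ((List.map_map ..).trans (List.map_congr_left fun t _ => ?_))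
    exact Prod.ext (Fin.ofNat_val_eq_self _) (Prod.ext (hmap _) (Prod.ext (hmap _)
      (Fin.ofNat_val_eq_self _)))
  rw [h, ← mem_transList]
  simp only [List.mem_toFinset, List.mem_map, Prod.mk.injEq, EmbeddingLike.apply_eq_iff_eq]
  constructor
  · rintro ⟨⟨_, _, _, _⟩, ht, rfl, rfl, rfl, rfl⟩
    exact ht
  · intro ht
    exact ⟨_, ht, rfl, rfl, rfl, rfl⟩

theorem code_rel_iff (n : ℕ) (α β : OmegaWord (Fin (m + 1))) :
    (D.code n).rel α β ↔ AccFrom (D.Trans n) Acc α β (.start, 0, 0) := by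
  classical
  refine (D.transducer n).rel_iff_accFrom stateEquiv (fun q u v q' => D.mem_transducer_trans)
    (fun q => ?_) _ rfl
  cases q <;> simp [transducer, TransducerCode.toTransducer, code, stateEquiv, List.getD, Acc]

theorem primrec_replicate {σ : Type*} [Primcodable σ] (a : σ) :
    Primrec fun n => List.replicate n a :=
  (Primrec.list_map Primrec.list_range (Primrec.const a).to₂).of_eq fun n => by
    simp [List.map_const']

/-- Only the transitions `short` and `full` depend on `n`, through a replicated letter. The other
transitions and the priorities are a constant, however they were chosen. -/
theorem computable_code : Computable D.code := by
  classical
  have hpre : Primrec fun i => (D.head :: D.first :: List.replicate i D.tail).map Fin.val := by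
    have := Primrec.list_cons.comp (Primrec.const D.head.val)
      (Primrec.list_cons.comp (Primrec.const D.first.val) (primrec_replicate D.tail.val))
    exact this.of_eq fun i => by simp
  -- Under `stateEquiv`, `row1`, `row2`, `row3` have the numbers 4, 5, 6.
  have hone : ∀ s : ℕ, Primrec fun i : ℕ => ((4 : ℕ),
      (D.head :: D.first :: List.replicate i D.tail).map Fin.val, ([] : List ℕ), s) := fun s =>
    (Primrec.const 4).pair (hpre.pair ((Primrec.const []).pair (Primrec.const s)))
  have htrans : Primrec fun n => (D.transList n).map encodeTrans := by
    have := Primrec.list_append.comp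
      (Primrec.const (D.finite_fixedTrans.toFinset.toList.map encodeTrans))
      (Primrec.list_append.comp
        (Primrec.list_map Primrec.list_range ((hone 5).comp Primrec.snd).to₂)
        (Primrec.list_cons.comp (hone 6) (Primrec.const [])))
    refine this.of_eq fun n => ?_
    simp only [transList, List.map_append, List.map_map]
    rfl
  have htuple : Primrec fun n => (13, m, m, 0, (D.transList n).map encodeTrans, (D.code 0).prio) :=
    (Primrec.const 13).pair ((Primrec.const m).pair ((Primrec.const m).pair
      ((Primrec.const 0).pair (htrans.pair (Primrec.const _)))))
  exact ((Primrec.of_equiv_symm (e := TransducerCode.equivTuple)).comp htuple).to_comp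

/-! ## Uniformization of the relation of the checking transducer -/

theorem hasTotalDomain_code (n : ℕ) : (D.code n).HasTotalDomain := by
  refine Set.eq_univ_of_forall fun α => ?_
  obtain ⟨β, hβ⟩ := exists_accFrom D n α
  exact ⟨β, (D.code_rel_iff n α β).2 hβ⟩

theorem uniformizes_truncateFun {n : ℕ} (h : ∀ α e p P, ¬ D.IsTrace n α e p P) :
    Uniformizes (truncateFun m) (D.code n).rel := by
  refine ⟨(Set.eq_univ_of_forall fun α => trivial).trans (D.hasTotalDomain_code n).symm,
    fun α β hβ => ?_⟩
  obtain rfl := Part.mem_some_iff.1 hβ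
  refine (D.code_rel_iff n α _).2 ?_
  by_cases hα : ∀ i j, i ≤ j → α i = 0 → α j = 0
  · rw [truncate_eq_self hα]
    exact accFrom_copy hα
  · push Not at hα
    obtain ⟨i, g, hig, hi, hg⟩ := hα
    classical
    have hex : ∃ i, α i = 0 := ⟨i, hi⟩
    have hmin : ∀ j < Nat.find hex, α j ≠ 0 := fun j hj => Nat.find_min hex hj
    have hle : Nat.find hex ≤ g := (Nat.find_min' hex hi).trans hig
    refine accFrom_of_not_isTrace hmin (Nat.find_spec hex)
      (lt_of_le_of_ne hle fun heq => hg (heq ▸ Nat.find_spec hex)) hg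
      (fun j hj => truncate_of_le hmin (Nat.find_spec hex) hj) fun p P => h _ _ _ _

theorem not_uniformizableBy_continuous {n e p P : ℕ} {α : OmegaWord (Fin (m + 1))}
    (hα : D.IsTrace n α e p P) : ¬ (D.code n).UniformizableBy IsContinuousFun := by
  rintro ⟨f, hf, hdom, hrel⟩
  -- Being a trace concerns only the letters up to `e`; as `P ≥ 3`, the rule never looks further.
  have hcongr : ∀ γ : OmegaWord (Fin (m + 1)), (∀ j ≤ e, γ j = α j) → D.IsTrace n γ e p P := by
    intro γ hγ
    have hP := hα.length_lt
    have hl := hα.le_length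
    refine ⟨⟨?_, fun j h1 h2 => ?_, ?_, ?_, fun j h => ?_, hl, fun j h1 h2 => ?_, ?_⟩,
      fun j hj => ?_, ?_, hP, fun j hj => ?_, ?_⟩
    · rw [hγ _ (by omega)]; exact hα.sep_zero
    · rw [hγ _ (by omega)]; exact hα.blank_left j h1 h2
    · rw [hγ _ (by omega)]; exact hα.head_eq
    · rw [hγ _ (by omega)]; exact hα.first_eq
    · rw [hγ _ (by omega)]; exact hα.tail_eq j h
    · rw [hγ _ (by omega)]; exact hα.blank_right j h1 h2
    · rw [hγ _ (by omega)]; exact hα.sep_length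
    · rw [hγ _ (by omega)]; exact hα.ne_zero j hj
    · rw [hγ _ (by omega)]; exact hα.end_zero
    · rw [hγ _ (by omega), hγ j (by omega), hγ (j + 1) (by omega), hγ (j + 2) (by omega)]
      exact hα.rule_eq j hj
    · obtain ⟨h, hh, hhalt⟩ := hα.halts
      exact ⟨h, hh, by rw [hγ _ hh.le]; exact hhalt⟩
  have hval : ∀ γ, ∃ fγ, fγ ∈ f γ := by
    intro γ
    have : γ ∈ f.Dom := by rw [hdom, D.hasTotalDomain_code n]; trivial
    exact ⟨_, Part.get_mem this⟩
  let γ₀ : OmegaWord (Fin (m + 1)) := fun j => if j < e then α j else 0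
  obtain ⟨f₀, hf₀⟩ := hval γ₀
  have heq : f₀ = γ₀ := by
    refine eq_of_accFrom ?_ ((D.code_rel_iff n γ₀ f₀).1 (hrel _ _ hf₀))
    intro i j hij h0
    have : e ≤ i := by
      by_contra hlt
      simp only [γ₀, if_pos (not_le.1 hlt)] at h0
      exact hα.ne_zero i (not_le.1 hlt) h0
    exact if_neg (not_lt.2 (this.trans hij))
  obtain ⟨j, hj⟩ := hf γ₀ f₀ hf₀ (e + 1)
  -- Agrees with `γ₀` long enough for continuity to fix `e + 1` output letters, and has a nonzero
  -- letter after the end marker.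
  let γ₁ : OmegaWord (Fin (m + 1)) := fun i => if i < j + e + 1 then γ₀ i else D.sep
  obtain ⟨f₁, hf₁⟩ := hval γ₁
  have hagree := hj γ₁ f₁ hf₁ fun i hi => by simp only [γ₁]; rw [if_pos (by omega)]
  have h₁ : ∀ i ≤ e, γ₁ i = α i := by
    intro i hi
    simp only [γ₁, γ₀]
    rw [if_pos (by omega)]
    split_ifs with h
    · rfl
    · rw [show i = e by omega, hα.end_zero]
  refine (hcongr γ₁ h₁).not_accFrom (g := j + e + 1) (by omega) ?_ ?_
    ((D.code_rel_iff n γ₁ f₁).1 (hrel _ _ hf₁))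
  · simp only [γ₁, lt_irrefl, if_false]
    exact D.sep_ne_zero
  · intro i hi
    rw [← hagree i (by omega), heq]
    simp only [γ₁]
    rw [if_pos (by omega)]

/-- If it is undecidable whether there are traces, then uniformizability by functions of a class
`C` between the continuous functions and the truncation functions is undecidable. -/
theorem not_decidableOn_uniformizableBy
    (hD : ¬ ComputablePred fun n => ∃ α e p P, D.IsTrace n α e p P) (C : FunClass)
    (hC : ∀ {A B : Type} (f : OmegaWord A →. OmegaWord B), C f → IsContinuousFun f)
    (hC' : ∀ m, C (truncateFun m)) :
    ¬ DecidableOn TransducerCode.HasTotalDomain (TransducerCode.UniformizableBy C) := by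
  rintro ⟨f, hf, hdec⟩
  choose b hb hb' using fun n => hdec (D.code n) (D.hasTotalDomain_code n)
  have hunif : ∀ n, (D.code n).UniformizableBy C ↔ ¬ ∃ α e p P, D.IsTrace n α e p P := by
    intro n
    constructor
    · rintro ⟨g, hg, hgu⟩ ⟨α, e, p, P, hT⟩
      exact D.not_uniformizableBy_continuous hT ⟨g, hC g hg, hgu⟩
    · intro h
      push Not at h
      exact ⟨truncateFun m, hC' m, D.uniformizes_truncateFun h⟩
  have hcomp : Computable b :=
    (hf.comp D.computable_code).of_eq fun n => Part.eq_some_iff.2 (hb n)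
  classical
  refine hD (ComputablePred.computable_iff.2 ⟨fun n => !(b n), Primrec.not.to_comp.comp hcomp, ?_⟩)
  funext n
  have := (hb' n).trans (hunif n)
  cases h : b n <;> simp_all

end RowSystem

theorem ComputablePred.decidableOn {X : Type} [Primcodable X] {P : X → Prop} (I : X → Prop)
    (h : ComputablePred P) : DecidableOn I P := by
  obtain ⟨f, hf, rfl⟩ := ComputablePred.computable_iff.1 h
  exact ⟨fun x => Part.some (f x), hf.partrec, fun x _ => ⟨f x, Part.mem_some _, Iff.rfl⟩⟩

/-! ## Space-time diagrams of Turing machines -/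

namespace Diagram

open Turing

/-- A cell of a space-time diagram: a tape symbol together with the state of the machine if its
head is there, or the border. -/
abbrev Cell (Γ Λ : Type) : Type := Option (Γ × Option Λ)

set_option linter.unusedSectionVars false

variable {Γ Λ : Type} [Inhabited Γ] [Inhabited Λ] (M : TM0.Machine Γ Λ)

open Classical in
/-- The state in which the head leaves a cell in direction `d`, if it does. -/
noncomputable def outgoing (d : Dir) : Cell Γ Λ → Option Λ
  | some (a, some q) => match M q a with
    | some (q', .move d') => if d' = d then some q' else none
    | _ => none
  | _ => none

/-- The next content of a cell. -/
noncomputable def nextCell (l c r : Cell Γ Λ) : Cell Γ Λ :=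
  match c with
  | none => none
  | some (a, some q) => match M q a with
    | none => some (a, some q)
    | some (q', .write b) => some (b, some q')
    | some (_, .move _) => some (a, none)
  | some (a, none) => some (a, (outgoing M .right l).or (outgoing M .left r))

/-- The head is not in the cell. -/
def Headless (c : Cell Γ Λ) : Prop := ∀ a q, c ≠ some (a, some q)

variable {M}

theorem headless_none : Headless (none : Cell Γ Λ) := fun _ _ h => nomatch h

theorem Headless.outgoing {c : Cell Γ Λ} (h : Headless c) (d : Dir) : outgoing M d c = none := by
  rcases c with _ | ⟨a, _ | q⟩
  · rfl
  · rfl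
  · exact absurd rfl (h a q)

theorem Headless.nextCell {l c r : Cell Γ Λ} (hl : Headless l) (hc : Headless c)
    (hr : Headless r) : Headless (nextCell M l c r) := by
  rcases c with _ | ⟨a, _ | q⟩
  · exact headless_none
  · simp only [Diagram.nextCell, hl.outgoing, hr.outgoing]
    intro a q h
    simp at h
  · exact absurd rfl (hc a q)

/-- A neighbour matters only through a head that leaves it. Thus a border may stand for any headless
tape cell outside the window. -/
theorem nextCell_congr {l l' c r r' : Cell Γ Λ} (hl : l = l' ∨ (Headless l ∧ Headless l'))
    (hr : r = r' ∨ (Headless r ∧ Headless r')) : nextCell M l c r = nextCell M l' c r' := by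
  have h1 : outgoing M .right l = outgoing M .right l' := by
    rcases hl with rfl | ⟨h, h'⟩
    · rfl
    · rw [h.outgoing, h'.outgoing]
  have h2 : outgoing M .left r = outgoing M .left r' := by
    rcases hr with rfl | ⟨h, h'⟩
    · rfl
    · rw [h.outgoing, h'.outgoing]
  unfold nextCell
  rw [h1, h2]

/-! ### Configurations in absolute coordinates -/

variable (M)

/-- One step of the machine, with the absolute position of the head; a halted machine stays as it
is. -/
def advance (c : TM0.Cfg Γ Λ × ℤ) : TM0.Cfg Γ Λ × ℤ :=
  match M c.1.q c.1.Tape.head with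
  | none => c
  | some (q, .write b) => (⟨q, c.1.Tape.write b⟩, c.2)
  | some (q, .move .left) => (⟨q, c.1.Tape.move .left⟩, c.2 - 1)
  | some (q, .move .right) => (⟨q, c.1.Tape.move .right⟩, c.2 + 1)

/-- The cell at the absolute position `x`. -/
def cellAt (c : TM0.Cfg Γ Λ × ℤ) (x : ℤ) : Cell Γ Λ :=
  some (c.1.Tape.nth (x - c.2), if x = c.2 then some c.1.q else none)

variable {M}

theorem cellAt_self (c : TM0.Cfg Γ Λ × ℤ) :
    cellAt c c.2 = some (c.1.Tape.head, some c.1.q) := by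
  simp [cellAt]

theorem cellAt_of_ne {c : TM0.Cfg Γ Λ × ℤ} {x : ℤ} (h : x ≠ c.2) :
    cellAt c x = some (c.1.Tape.nth (x - c.2), none) := by
  simp [cellAt, h]

theorem headless_cellAt {c : TM0.Cfg Γ Λ × ℤ} {x : ℤ} (h : x ≠ c.2) : Headless (cellAt c x) := by
  rw [cellAt_of_ne h]
  intro a q h
  simp at h

theorem head_move_left (T : Tape Γ) : (T.move .left).head = T.nth (-1) := by
  rw [← Tape.nth_zero, Tape.move_left_nth, zero_sub]

theorem head_move_right (T : Tape Γ) : (T.move .right).head = T.nth 1 := by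
  rw [← Tape.nth_zero, Tape.move_right_nth, zero_add]

/-- `Tape.move` shifts the tape under the head; the absolute head position compensates for this, so
only cells at or next to the head can change. -/
theorem cellAt_advance (c : TM0.Cfg Γ Λ × ℤ) (x : ℤ) :
    cellAt (advance M c) x = nextCell M (cellAt c (x - 1)) (cellAt c x) (cellAt c (x + 1)) := by
  by_cases hx : x = c.2
  · subst hx
    rw [cellAt_self]
    unfold nextCell advance
    rcases h : M c.1.q c.1.Tape.head with _ | ⟨q, (_ | _) | b⟩
    · simp [cellAt, h]
    · simp [cellAt, h, show c.2 ≠ c.2 - 1 by omega]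
    · simp [cellAt, h]
    · simp [cellAt, h, Tape.write]
  · rw [cellAt_of_ne hx]
    unfold nextCell
    have hl : x - 1 ≠ c.2 → outgoing M .right (cellAt c (x - 1)) = none := fun h =>
      (headless_cellAt h).outgoing _
    have hr : x + 1 ≠ c.2 → outgoing M .left (cellAt c (x + 1)) = none := fun h =>
      (headless_cellAt h).outgoing _
    have hl' : x - 1 = c.2 → outgoing M .right (cellAt c (x - 1)) =
        outgoing M .right (some (c.1.Tape.head, some c.1.q)) := fun h => by rw [h, cellAt_self]
    have hr' : x + 1 = c.2 → outgoing M .left (cellAt c (x + 1)) =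
        outgoing M .left (some (c.1.Tape.head, some c.1.q)) := fun h => by rw [h, cellAt_self]
    dsimp only
    unfold advance
    by_cases h1 : x - 1 = c.2
    · rw [hl' h1, hr (by omega)]
      obtain rfl : x = c.2 + 1 := by omega
      rcases h : M c.1.q c.1.Tape.head with _ | ⟨q, (_ | _) | b⟩ <;>
        simp [cellAt, outgoing, h, head_move_right]
      all_goals omega
    · rw [hl h1]
      by_cases h2 : x + 1 = c.2
      · rw [hr' h2]
        obtain rfl : x = c.2 - 1 := by omega
        rcases h : M c.1.q c.1.Tape.head with _ | ⟨q, (_ | _) | b⟩ <;>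
          simp [cellAt, outgoing, h, head_move_left]
        exact ⟨by congr 1; omega, by omega⟩
      · rw [hr h2]
        have h3 : x ≠ c.2 - 1 := by omega
        have h4 : x ≠ c.2 + 1 := by omega
        have h5 : x - c.2 ≠ 0 := by omega
        rcases h : M c.1.q c.1.Tape.head with _ | ⟨q, (_ | _) | b⟩
        · simp [cellAt, hx]
        · simp [cellAt, h3, show x - (c.2 - 1) - 1 = x - c.2 by ring]
        · simp [cellAt, h4, show x - (c.2 + 1) + 1 = x - c.2 by ring]
        · simp [cellAt, hx, h5]

/-! ### Iterated steps and halting -/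

variable (M)

/-- The configuration after `t` steps on input `l`. -/
def history (l : List Γ) (t : ℕ) : TM0.Cfg Γ Λ × ℤ := (advance M)^[t] (TM0.init l, 0)

variable {M}

theorem history_succ (l : List Γ) (t : ℕ) :
    history M l (t + 1) = advance M (history M l t) :=
  Function.iterate_succ_apply' _ _ _

theorem abs_history_le (l : List Γ) (t : ℕ) : |(history M l t).2| ≤ t := by
  induction t with
  | zero => simp [history]
  | succ t ih =>
    rw [history_succ, advance]
    rw [abs_le] at ih ⊢
    push_cast
    split <;> constructor <;> (try dsimp only) <;> omega

theorem step_eq (c : TM0.Cfg Γ Λ × ℤ) :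
    (M c.1.q c.1.Tape.head = none ∧ TM0.step M c.1 = none) ∨
      TM0.step M c.1 = some (advance M c).1 := by
  obtain ⟨⟨q, T⟩, h⟩ := c
  unfold advance TM0.step
  rcases h : M q T.head with _ | ⟨q, (_ | _) | b⟩ 
  · simp [h]
  all_goals simp [h]

/-- Since `advance` idles after halting, `history` is total and reaches every configuration of the
computation. -/
theorem eval_dom_iff (l : List Γ) : (TM0.eval M l).Dom ↔
    ∃ t, M (history M l t).1.q (history M l t).1.Tape.head = none := by
  have hdom : (TM0.eval M l).Dom ↔ ∃ b, b ∈ StateTransition.eval (TM0.step M) (TM0.init l) :=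
    Part.dom_iff_mem (o := StateTransition.eval (TM0.step M) (TM0.init l))
  simp only [hdom, StateTransition.mem_eval]
  constructor
  · rintro ⟨b, hb, hb'⟩
    have : ∃ t, (history M l t).1 = b := by
      clear hb'
      induction hb with
      | refl => exact ⟨0, rfl⟩
      | tail _ h ih =>
        obtain ⟨t, rfl⟩ := ih
        refine ⟨t + 1, ?_⟩
        rw [history_succ]
        rcases step_eq (M := M) (history M l t) with ⟨-, h'⟩ | h'
        · rw [h'] at h; exact nomatch h
        · rw [h'] at h; exact Option.some.inj h
    obtain ⟨t, rfl⟩ := this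
    rcases step_eq (M := M) (history M l t) with ⟨h', -⟩ | h'
    · exact ⟨t, h'⟩
    · rw [h'] at hb'; exact nomatch hb'
  · rintro ⟨t, ht⟩
    refine ⟨(history M l t).1, ?_, ?_⟩
    · clear ht
      induction t with
      | zero => exact .refl
      | succ t ih =>
        rw [history_succ]
        rcases step_eq (M := M) (history M l t) with ⟨h, -⟩ | h
        · rw [advance, h]; exact ih
        · exact ih.tail h
    · simp [TM0.step, ht]

/-! ### The first row -/

theorem nth_mk₁_natCast (l : List Γ) (k : ℕ) : (Tape.mk₁ l).nth k = l.getI k := by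
  rw [Tape.mk₁, Tape.mk₂, Tape.mk'_nth_nat, ListBlank.nth_mk]

theorem nth_mk₁_of_neg (l : List Γ) {z : ℤ} (hz : z < 0) : (Tape.mk₁ l).nth z = default := by
  obtain ⟨k, rfl⟩ : ∃ k : ℕ, z = -((k + 1 : ℕ) : ℤ) := ⟨(-z - 1).toNat, by omega⟩
  change (ListBlank.mk ([] : List Γ)).nth k = default
  simp [ListBlank.nth_mk]

variable (a₀ a₁ a₂ : Γ) (n : ℕ)

/-- The initial configuration on a word of the form `a₀ a₁ a₂ ⋯ a₂`. -/
def initial : TM0.Cfg Γ Λ × ℤ := (TM0.init (a₀ :: a₁ :: List.replicate n a₂), 0)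

theorem cellAt_initial_neg {z : ℤ} (hz : z < 0) :
    cellAt (initial a₀ a₁ a₂ n : TM0.Cfg Γ Λ × ℤ) z = some (default, none) := by
  rw [cellAt_of_ne (by simp [initial]; omega)]
  simp [initial, TM0.init, nth_mk₁_of_neg _ hz]

theorem cellAt_initial_zero :
    cellAt (initial a₀ a₁ a₂ n : TM0.Cfg Γ Λ × ℤ) 0 = some (a₀, some default) :=
  cellAt_self _

theorem cellAt_initial_natCast {k : ℕ} (hk : k ≠ 0) :
    cellAt (initial a₀ a₁ a₂ n : TM0.Cfg Γ Λ × ℤ) k =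
      some ((a₀ :: a₁ :: List.replicate n a₂).getI k, none) := by
  rw [cellAt_of_ne (by simp [initial]; omega)]
  simp [initial, TM0.init, nth_mk₁_natCast]

theorem cellAt_initial_one :
    cellAt (initial a₀ a₁ a₂ n : TM0.Cfg Γ Λ × ℤ) 1 = some (a₁, none) :=
  cellAt_initial_natCast a₀ a₁ a₂ n one_ne_zero

theorem cellAt_initial_tail {j : ℕ} (hj : j < n) :
    cellAt (initial a₀ a₁ a₂ n : TM0.Cfg Γ Λ × ℤ) (j + 2 : ℕ) = some (a₂, none) := by
  rw [cellAt_initial_natCast _ _ _ _ (by omega)]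
  simp [List.getI, hj]

theorem cellAt_initial_right {j : ℕ} (hj : n ≤ j) :
    cellAt (initial a₀ a₁ a₂ n : TM0.Cfg Γ Λ × ℤ) (j + 2 : ℕ) = some (default, none) := by
  rw [cellAt_initial_natCast _ _ _ _ (by omega)]
  simp [List.getI, hj]

/-! ### The row system of a Turing machine -/

variable (M)
variable [Finite Γ] [Finite Λ]

/-- Number of cell contents. -/
noncomputable def cellCard (Γ Λ : Type) : ℕ := Nat.card (Cell Γ Λ)

/-- Cells as nonzero letters. -/
noncomputable def letter (c : Cell Γ Λ) : Fin (cellCard Γ Λ + 1) :=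
  (Finite.equivFin (Cell Γ Λ) c).succ

/-- Letters as cells. -/
noncomputable def unletter (a : Fin (cellCard Γ Λ + 1)) : Cell Γ Λ :=
  Fin.cases none (Finite.equivFin (Cell Γ Λ)).symm a

theorem unletter_letter (c : Cell Γ Λ) : unletter (letter c) = c :=
  (Finite.equivFin (Cell Γ Λ)).symm_apply_apply c

theorem letter_injective : Function.Injective (letter (Γ := Γ) (Λ := Λ)) :=
  Function.LeftInverse.injective unletter_letter

theorem letter_ne_zero (c : Cell Γ Λ) : letter c ≠ 0 := Fin.succ_ne_zero _

/-- The row system whose traces are the halting space-time diagrams of the machine `M` on the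
words `a₀ a₁ a₂ ⋯ a₂`. -/
noncomputable def rowSystem : RowSystem (cellCard Γ Λ) where
  sep := letter (none : Cell Γ Λ)
  blank := letter (some (default, none) : Cell Γ Λ)
  head := letter (some (a₀, some default) : Cell Γ Λ)
  first := letter (some (a₁, none) : Cell Γ Λ)
  tail := letter (some (a₂, none) : Cell Γ Λ)
  rule a b c := letter (nextCell M (unletter a) (unletter b) (unletter c))
  halting a := ∃ g q, a = letter (some (g, some q) : Cell Γ Λ) ∧ M q g = none
  sep_ne_zero := letter_ne_zero _
  blank_ne_zero := letter_ne_zero _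
  head_ne_zero := letter_ne_zero _
  first_ne_zero := letter_ne_zero _
  tail_ne_zero := letter_ne_zero _
  blank_ne_sep := letter_injective.ne (by simp)
  head_ne_sep := letter_injective.ne (by simp)
  first_ne_sep := letter_injective.ne (by simp)
  tail_ne_sep := letter_injective.ne (by simp)
  head_ne_blank := letter_injective.ne (by simp)

/-! ### Traces and halting computations -/

variable {M a₀ a₁ a₂ n}

/-- The first row shows the initial configuration. -/
theorem unletter_firstRow {α : OmegaWord (Fin (cellCard Γ Λ + 1))} {p P : ℕ}
    (hα : (rowSystem M a₀ a₁ a₂).IsFirstRow n α p P) {i : ℕ} (hi : 1 ≤ i) (hiP : i < P) :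
    (unletter (α i) : Cell Γ Λ) = cellAt (initial a₀ a₁ a₂ n) ((i : ℤ) - 1 - p) := by
  by_cases h1 : i ≤ p
  · rw [hα.blank_left i hi h1, cellAt_initial_neg _ _ _ _ (by omega)]
    exact unletter_letter _
  by_cases h2 : i = p + 1
  · rw [h2, hα.head_eq, show ((p + 1 : ℕ) : ℤ) - 1 - p = 0 by push_cast; ring,
      cellAt_initial_zero]
    exact unletter_letter _
  by_cases h3 : i = p + 2
  · rw [h3, hα.first_eq, show ((p + 2 : ℕ) : ℤ) - 1 - p = 1 by push_cast; ring,
      cellAt_initial_one]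
    exact unletter_letter _
  obtain ⟨j, rfl⟩ : ∃ j, i = p + 3 + j := ⟨i - (p + 3), by omega⟩
  rw [show ((p + 3 + j : ℕ) : ℤ) - 1 - p = (j + 2 : ℕ) by push_cast; ring]
  by_cases h4 : j < n
  · rw [hα.tail_eq j h4, cellAt_initial_tail _ _ _ _ h4]
    exact unletter_letter _
  · rw [hα.blank_right _ (by omega) hiP, cellAt_initial_right _ _ _ _ (by omega)]
    exact unletter_letter _

/-- The rows follow the machine while its head stays in the window. A head that leaves is absorbed
by the border, and all later rows are headless. So a halting letter shows a genuine halting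
configuration. -/
theorem eval_dom_of_isTrace {α : OmegaWord (Fin (cellCard Γ Λ + 1))} {e p P : ℕ}
    (hα : (rowSystem M a₀ a₁ a₂).IsTrace n α e p P) :
    (TM0.eval M (a₀ :: a₁ :: List.replicate n a₂)).Dom := by
  rw [eval_dom_iff]
  obtain ⟨c, hc⟩ : ∃ c : ℕ → Cell Γ Λ, ∀ j, c j = unletter (α j) := ⟨_, fun _ => rfl⟩
  have hpP := hα.le_length
  have hrule : ∀ j, j + 1 + P < e → c (j + 1 + P) = nextCell M (c j) (c (j + 1)) (c (j + 2)) := by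
    intro j hj
    simp only [hc]
    rw [hα.rule_eq j hj]
    exact unletter_letter _
  -- The rule determines letters only from position `P + 1` on, so the separator at `P` comes from
  -- the first row; later ones are inherited, as borders stay borders.
  have hsep : ∀ t, t * P < e → c (t * P) = none := by
    intro t
    induction t with
    | zero => intro _; rw [zero_mul, hc, hα.sep_zero]; exact unletter_letter _
    | succ t ih =>
      intro ht
      rw [Nat.add_mul, one_mul] at ht ⊢
      rcases Nat.eq_zero_or_pos t with rfl | hpos
      · rw [zero_mul, zero_add, hc, hα.sep_length]; exact unletter_letter _
      · obtain ⟨j, hj⟩ : ∃ j, t * P = j + 1 :=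
          ⟨t * P - 1, by have := Nat.mul_pos hpos (show 0 < P by omega); omega⟩
        have h0 := ih (by omega)
        rw [hj] at h0 ht ⊢
        rw [hrule j ht, h0]
        rfl
  have hnext : ∀ t i, 1 ≤ i → t * P + P + i < e → c (t * P + P + i) =
      nextCell M (c (t * P + (i - 1))) (c (t * P + i)) (c (t * P + (i + 1))) := by
    intro t i hi hlt
    have := hrule (t * P + (i - 1)) (by omega)
    rw [show t * P + (i - 1) + 1 + P = t * P + P + i by omega,
      show t * P + (i - 1) + 1 = t * P + i by omega,
      show t * P + (i - 1) + 2 = t * P + (i + 1) by omega] at this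
    exact this
  have hmain : ∀ t, (∀ i, 1 ≤ i → i < P → t * P + i < e → Headless (c (t * P + i))) ∨
      ((1 ≤ (history M (a₀ :: a₁ :: List.replicate n a₂) t).2 + 1 + p ∧
        (history M (a₀ :: a₁ :: List.replicate n a₂) t).2 + 1 + p < P) ∧
        ∀ i, 1 ≤ i → i < P → t * P + i < e → c (t * P + i) =
          cellAt (history M (a₀ :: a₁ :: List.replicate n a₂) t) ((i : ℤ) - 1 - p)) := by
    intro t
    induction t with
    | zero =>
      refine Or.inr ⟨?_, fun i h1 h2 _ => ?_⟩
      · simp only [history, Function.iterate_zero, id_eq]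
        omega
      · rw [zero_mul, zero_add, hc]
        exact unletter_firstRow hα.toIsFirstRow h1 h2
    | succ t ih =>
      rw [Nat.add_mul, one_mul]
      have hsepr : ∀ i, i + 1 = P → t * P + P < e → c (t * P + (i + 1)) = none := by
        intro i hi hlt
        have := hsep (t + 1) (by rw [Nat.add_mul, one_mul]; exact hlt)
        rwa [Nat.add_mul, one_mul, ← congrArg (t * P + ·) hi] at this
      have hsepl : ∀ i, i = 1 → t * P + P < e → c (t * P + (i - 1)) = none := by
        intro i hi hlt
        rw [hi]
        exact hsep t (by omega)
      rcases ih with ih | ⟨⟨hw1, hw2⟩, ih⟩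
      · refine Or.inl fun i h1 h2 h3 => ?_
        rw [hnext t i h1 h3]
        refine Headless.nextCell ?_ (ih i h1 h2 (by omega)) ?_
        · by_cases hi : i = 1
          · rw [hsepl i hi (by omega)]; exact headless_none
          · exact ih _ (by omega) (by omega) (by omega)
        · by_cases hi : i + 1 = P
          · rw [hsepr i hi (by omega)]; exact headless_none
          · exact ih _ (by omega) (by omega) (by omega)
      · have hcell : ∀ i, 1 ≤ i → i < P → t * P + P + i < e → c (t * P + P + i) =
            cellAt (history M (a₀ :: a₁ :: List.replicate n a₂) (t + 1)) ((i : ℤ) - 1 - p) := by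
          intro i h1 h2 h3
          rw [hnext t i h1 h3, history_succ, cellAt_advance, ih i h1 h2 (by omega)]
          refine nextCell_congr ?_ ?_
          · by_cases hi : i = 1
            · rw [hsepl i hi (by omega)]
              exact Or.inr ⟨headless_none, headless_cellAt (by omega)⟩
            · rw [ih _ (by omega) (by omega) (by omega)]
              left; congr 1; push_cast [Nat.cast_sub h1]; ring
          · by_cases hi : i + 1 = P
            · rw [hsepr i hi (by omega)]
              exact Or.inr ⟨headless_none, headless_cellAt (by omega)⟩
            · rw [ih _ (by omega) (by omega) (by omega)]
              left; congr 1; push_cast; ring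
        by_cases hw : 1 ≤ (history M (a₀ :: a₁ :: List.replicate n a₂) (t + 1)).2 + 1 + p ∧
            (history M (a₀ :: a₁ :: List.replicate n a₂) (t + 1)).2 + 1 + p < P
        · exact Or.inr ⟨hw, hcell⟩
        · refine Or.inl fun i h1 h2 h3 => ?_
          rw [hcell i h1 h2 h3]
          exact headless_cellAt (by omega)
  obtain ⟨h, hhe, g, q, hh, hM⟩ := hα.halts
  have hch : c h = some (g, some q) := by rw [hc, hh, unletter_letter]
  have hdiv : h / P * P + h % P = h := Nat.div_add_mod' h P
  have hmod : h % P < P := Nat.mod_lt _ (by omega)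
  have hpos : 1 ≤ h % P := by
    by_contra h0
    have := hsep (h / P) (by omega)
    rw [show h / P * P = h by omega, hch] at this
    simp at this
  refine ⟨h / P, ?_⟩
  rcases hmain (h / P) with hd | ⟨-, hd⟩
  · have := hd (h % P) hpos hmod (by omega)
    rw [hdiv] at this
    exact absurd hch (this g q)
  · have := hd (h % P) hpos hmod (by omega)
    rw [hdiv, hch] at this
    by_cases hx : ((h % P : ℕ) : ℤ) - 1 - p = (history M (a₀ :: a₁ :: List.replicate n a₂) (h / P)).2
    · rw [hx, cellAt_self] at this
      simp only [Option.some.injEq, Prod.mk.injEq] at this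
      rw [← this.1, ← this.2]
      exact hM
    · exact absurd this.symm (headless_cellAt hx g q)

theorem exists_isTrace_of_eval_dom (h : (TM0.eval M (a₀ :: a₁ :: List.replicate n a₂)).Dom) :
    ∃ α e p P, (rowSystem M a₀ a₁ a₂).IsTrace n α e p P := by
  obtain ⟨K, hK⟩ := (eval_dom_iff _).1 h
  -- `K` extra blanks on either side keep the head inside the window during `K` steps.
  obtain ⟨P, hP⟩ : ∃ P, P = K + 3 + n + K := ⟨_, rfl⟩
  have hP0 : 0 < P := by omega
  obtain ⟨H, hH⟩ : ∃ H, H = history M (a₀ :: a₁ :: List.replicate n a₂) := ⟨_, rfl⟩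
  have hpos : ∀ t ≤ K, -(K : ℤ) ≤ (H t).2 ∧ (H t).2 ≤ K := by
    intro t ht
    have := abs_history_le (M := M) (a₀ :: a₁ :: List.replicate n a₂) t
    rw [abs_le, ← hH] at this
    omega
  obtain ⟨c, hc⟩ : ∃ c : ℕ → Cell Γ Λ, ∀ t i, i < P → c (t * P + i) =
      if i = 0 then none else cellAt (H t) ((i : ℤ) - 1 - K) := by
    refine ⟨fun j => if j % P = 0 then none else cellAt (H (j / P)) (((j % P : ℕ) : ℤ) - 1 - K),
      fun t i hi => ?_⟩
    have h1 : (t * P + i) % P = i := by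
      rw [Nat.mul_comm, Nat.mul_add_mod, Nat.mod_eq_of_lt hi]
    have h2 : (t * P + i) / P = t := by
      rw [Nat.mul_comm, Nat.mul_add_div hP0, Nat.div_eq_of_lt hi, add_zero]
    simp only [h1, h2]
  have hc0 : ∀ i, 1 ≤ i → i < P → c i = cellAt (initial a₀ a₁ a₂ n) ((i : ℤ) - 1 - K) := by
    intro i h1 h2
    have := hc 0 i h2
    rw [zero_mul, zero_add, if_neg (by omega), hH] at this
    exact this
  have hcsep : ∀ t, c (t * P) = none := fun t => by simpa using hc t 0 hP0
  have hnext : ∀ t i, t ≤ K → i < P → 1 ≤ t * P + i → c (t * P + i + P) =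
      nextCell M (c (t * P + i - 1)) (c (t * P + i)) (c (t * P + i + 1)) := by
    intro t i ht hi h1
    have hadd : t * P + i + P = (t + 1) * P + i := by ring
    rw [hadd, hc _ _ hi, hc _ _ hi]
    by_cases hi0 : i = 0
    · simp only [if_pos hi0]; rfl
    rw [if_neg hi0, if_neg hi0, hH, history_succ, cellAt_advance, ← hH]
    refine nextCell_congr ?_ ?_
    · rw [show t * P + i - 1 = t * P + (i - 1) by omega, hc _ _ (by omega)]
      split_ifs with hi1
      · have := hpos t ht
        exact Or.inr ⟨headless_cellAt (by omega), headless_none⟩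
      · left; congr 1; push_cast [Nat.cast_sub (show 1 ≤ i by omega)]; ring
    · by_cases hi1 : i + 1 = P
      · rw [show t * P + i + 1 = (t + 1) * P by rw [Nat.add_mul]; omega, hcsep]
        have := hpos t ht
        exact Or.inr ⟨headless_cellAt (by omega), headless_none⟩
      · rw [add_assoc, hc _ _ (by omega), if_neg (by omega)]
        left; congr 1; push_cast; ring
  -- The rows of times `0` to `K`, each with its leading separator, and a final separator at `(K +
  -- 1) * P`.
  obtain ⟨e, he⟩ : ∃ e, e = K * P + P + 1 := ⟨_, rfl⟩
  obtain ⟨α, hαe, hα⟩ : ∃ α : OmegaWord (Fin (cellCard Γ Λ + 1)), α e = 0 ∧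
      ∀ j < e, α j = letter (c j) :=
    ⟨fun j => if j < e then letter (c j) else 0, by simp, fun j hj => if_pos hj⟩
  have hu : ∀ j < e, (unletter (α j) : Cell Γ Λ) = c j := fun j hj => by
    rw [hα j hj, unletter_letter]
  have hrow : ∀ i, 1 ≤ i → i < P →
      α i = letter (cellAt (initial a₀ a₁ a₂ n : TM0.Cfg Γ Λ × ℤ) ((i : ℤ) - 1 - K)) := by
    intro i h1 h2
    rw [hα i (by omega), hc0 i h1 h2]
  have hsep : ∀ t ≤ K + 1, α (t * P) = letter (none : Cell Γ Λ) := by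
    intro t ht
    have := Nat.mul_le_mul_right P ht
    rw [hα _ (by rw [Nat.add_mul] at this; omega), hcsep]
  refine ⟨α, e, K, P, ⟨?_, fun j h1 h2 => ?_, ?_, ?_, fun j hj => ?_, by omega,
    fun j h1 h2 => ?_, ?_⟩, fun j hj => ?_, hαe, by omega, fun j hj => ?_, ?_⟩
  · have := hsep 0 (by omega)
    rwa [zero_mul] at this
  · rw [hrow j h1 (by omega), cellAt_initial_neg _ _ _ _ (by omega)]
    rfl
  · rw [hrow _ (by omega) (by omega), show ((K + 1 : ℕ) : ℤ) - 1 - K = 0 by push_cast; ring,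
      cellAt_initial_zero]
    rfl
  · rw [hrow _ (by omega) (by omega), show ((K + 2 : ℕ) : ℤ) - 1 - K = 1 by push_cast; ring,
      cellAt_initial_one]
    rfl
  · rw [hrow _ (by omega) (by omega),
      show ((K + 3 + j : ℕ) : ℤ) - 1 - K = (j + 2 : ℕ) by push_cast; ring,
      cellAt_initial_tail _ _ _ _ hj]
    rfl
  · obtain ⟨i, rfl⟩ : ∃ i, j = K + 3 + i := ⟨j - (K + 3), by omega⟩
    rw [hrow _ (by omega) (by omega),
      show ((K + 3 + i : ℕ) : ℤ) - 1 - K = (i + 2 : ℕ) by push_cast; ring,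
      cellAt_initial_right _ _ _ _ (by omega)]
    rfl
  · have := hsep 1 (by omega)
    rwa [one_mul] at this
  · rw [hα j hj]
    exact letter_ne_zero _
  · have hmod : (j + 1) % P < P := Nat.mod_lt _ hP0
    have hdiv : (j + 1) / P * P + (j + 1) % P = j + 1 := Nat.div_add_mod' _ _
    have hle : (j + 1) / P ≤ K := by
      by_contra hlt
      have := Nat.mul_le_mul_right P (not_le.1 hlt)
      rw [Nat.succ_mul] at this
      omega
    have := hnext _ _ hle hmod (by omega)
    rw [hdiv] at this
    rw [hα _ hj, this]
    change _ = letter (nextCell M (unletter (α j)) (unletter (α (j + 1))) (unletter (α (j + 2))))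
    rw [hu _ (by omega), hu _ (by omega), hu _ (by omega)]
    rfl
  · obtain ⟨i, hi⟩ := Int.eq_ofNat_of_zero_le
      (show 0 ≤ (H K).2 + 1 + K by have := hpos K le_rfl; omega)
    have hiK := hpos K le_rfl
    refine ⟨K * P + i, by omega, (H K).1.Tape.head, (H K).1.q, ?_, hH ▸ hK⟩
    rw [hα _ (by omega), hc _ _ (by omega), if_neg (by omega),
      show (i : ℤ) - 1 - K = (H K).2 by omega, cellAt_self]

end Diagram

/-! ## A Turing machine with an undecidable halting problem -/

section Undecidable

open Turing

theorem exists_finite_machine {Γ Λ : Type} [Inhabited Γ] [Inhabited Λ] (M : TM0.Machine Γ Λ)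
    (S : Finset Λ) (hS : TM0.Supports M ↑S) :
    ∃ (Λ' : Type) (_ : Inhabited Λ') (_ : Finite Λ') (M' : TM0.Machine Γ Λ'),
      ∀ l, (TM0.eval M' l).Dom ↔ (TM0.eval M l).Dom := by
  classical
  let inst : Inhabited S := ⟨⟨default, hS.1⟩⟩
  -- The default is never used, because `S` is closed under the transitions of `M`.
  let M' : TM0.Machine Γ S := fun q a =>
    (M q a).map fun r => (if h : r.1 ∈ S then ⟨r.1, h⟩ else default, r.2)
  refine ⟨S, inst, inferInstance, M', fun l => ?_⟩
  have hresp : StateTransition.Respects (TM0.step M') (TM0.step M)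
      fun c c' => (⟨c.q.1, c.Tape⟩ : TM0.Cfg Γ Λ) = c' := by
    refine StateTransition.fun_respects.2 fun c => ?_
    obtain ⟨q, T⟩ := c
    rcases h : M q.1 T.head with _ | ⟨q', s⟩
    · simp [StateTransition.FRespects, TM0.step, M', h]
    · have hq' : q' ∈ S := hS.2 h q.2
      simp only [TM0.step, M', h, Option.map_some, hq', dif_pos, StateTransition.FRespects]
      exact Relation.TransGen.single (by simp [TM0.step, h])
  exact (StateTransition.tr_eval_dom hresp (a₁ := TM0.init l) (a₂ := TM0.init l) rfl).symm

/-- Digits are written least significant first, so a power of two is a unary numeral closed by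
`bit1`. This gives inputs of the shape `a₀ a₁ a₂ ⋯ a₂`. -/
theorem trNat_two_pow (n : ℕ) :
    PartrecToTM2.trNat (2 ^ n) =
      List.replicate n PartrecToTM2.Γ'.bit0 ++ [PartrecToTM2.Γ'.bit1] := by
  obtain ⟨p, hp, hp'⟩ : ∃ p : PosNum, ((2 ^ n : ℕ) : Num) = Num.pos p ∧
      PartrecToTM2.trPosNum p =
        List.replicate n PartrecToTM2.Γ'.bit0 ++ [PartrecToTM2.Γ'.bit1] := by
    induction n with
    | zero => exact ⟨1, by simp; rfl, rfl⟩
    | succ n ih =>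
      obtain ⟨p, hp, hp'⟩ := ih
      refine ⟨p.bit0, ?_, ?_⟩
      · rw [pow_succ, mul_two, Nat.cast_add, hp, Num.bit0_of_bit0]
        rfl
      · rw [PartrecToTM2.trPosNum, hp', List.replicate_succ]
        rfl
  rw [PartrecToTM2.trNat, hp, PartrecToTM2.trNum, hp']

instance : Finite PartrecToTM2.K' := by
  refine Finite.of_surjective
    (fun i : Fin 4 => (![.main, .rev, .aux, .stack] i : PartrecToTM2.K')) fun k => ?_
  cases k
  exacts [⟨0, rfl⟩, ⟨1, rfl⟩, ⟨2, rfl⟩, ⟨3, rfl⟩]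

/-- Every code for partial recursive functions on lists can be executed by a finite Turing machine
that receives powers of two in unary notation. -/
theorem exists_machine_of_code (c : ToPartrec.Code) :
    ∃ (Γ Λ : Type) (_ : Inhabited Γ) (_ : Inhabited Λ) (_ : Finite Γ) (_ : Finite Λ)
      (M : TM0.Machine Γ Λ) (a₀ a₁ a₂ : Γ),
      ∀ n, (TM0.eval M (a₀ :: a₁ :: List.replicate n a₂)).Dom ↔ (c.eval [2 ^ n]).Dom := by
  -- Machines start in the default state, which therefore has to be the entry point of `c`.
  let instΛ : Inhabited PartrecToTM2.Λ' := ⟨PartrecToTM2.trNormal c .halt⟩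
  have hsupp := @TM1to0.tr_supports _ _ _ _ _ (TM2to1.tr PartrecToTM2.tr) _ _
    (TM2to1.tr_supports PartrecToTM2.tr (PartrecToTM2.tr_supports c .halt))
  obtain ⟨Λ, hΛ, hΛ', M, hM⟩ := exists_finite_machine _ _ hsupp
  let L : PartrecToTM2.Γ' → TM2to1.Γ' PartrecToTM2.K' (fun _ => PartrecToTM2.Γ') := fun a =>
    (false, Function.update (fun _ => none) PartrecToTM2.K'.main (some a))
  refine ⟨TM2to1.Γ' PartrecToTM2.K' (fun _ => PartrecToTM2.Γ'), Λ, inferInstance, hΛ,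
    inferInstanceAs (Finite (Bool × (PartrecToTM2.K' → Option PartrecToTM2.Γ'))), hΛ', M,
    (true, (L .cons).2), L .bit1, L .bit0, fun n => ?_⟩
  -- The input is stored in reverse, with `cons` and the leading bit in front; the flag `true` marks
  -- the bottom of the stacks.
  have hinit : TM2to1.trInit PartrecToTM2.K'.main (PartrecToTM2.trList [2 ^ n]) =
      (true, (L .cons).2) :: L .bit1 :: List.replicate n (L .bit0) := by
    have hrev : (PartrecToTM2.trList [2 ^ n]).reverse =
        .cons :: .bit1 :: List.replicate n .bit0 := by
      simp [PartrecToTM2.trList, trNat_two_pow]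
    unfold TM2to1.trInit
    rw [hrev]
    change (true, (L .cons).2) :: L .bit1 :: (List.replicate n .bit0).map L = _
    rw [List.map_replicate]
  have htm2 : (TM2.init PartrecToTM2.K'.main (PartrecToTM2.trList [2 ^ n]) :
      TM2.Cfg (fun _ : PartrecToTM2.K' => PartrecToTM2.Γ') PartrecToTM2.Λ'
        (Option PartrecToTM2.Γ')) = PartrecToTM2.init c [2 ^ n] := by
    unfold TM2.init PartrecToTM2.init
    congr 1
    funext k
    cases k <;> rfl
  have heval := PartrecToTM2.tr_eval c [2 ^ n]
  rw [← htm2] at heval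
  have hdom : ∀ l, TM2to1.trInit PartrecToTM2.K'.main (PartrecToTM2.trList [2 ^ n]) = l →
      ((TM0.eval M l).Dom ↔ (c.eval [2 ^ n]).Dom) := by
    rintro _ rfl
    exact (hM _).trans ((iff_of_eq (congrArg Part.Dom (TM1to0.tr_eval _ _))).trans
      ((TM2to1.tr_eval_dom PartrecToTM2.tr _ _).trans (iff_of_eq (congrArg Part.Dom heval))))
  exact hdom _ hinit

theorem exists_undecidable_machine :
    ∃ (Γ Λ : Type) (_ : Inhabited Γ) (_ : Inhabited Λ) (_ : Finite Γ) (_ : Finite Λ)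
      (M : TM0.Machine Γ Λ) (a₀ a₁ a₂ : Γ),
      ¬ ComputablePred fun n => (TM0.eval M (a₀ :: a₁ :: List.replicate n a₂)).Dom := by
  -- A search recovers `n` from `2 ^ n`; then the `n`-th code is run on `0`, whose halting is
  -- undecidable.
  let f : ℕ →. ℕ := fun k => (Nat.rfind fun n => Part.some (decide (2 ^ n = k))).bind fun n =>
    (Denumerable.ofNat Nat.Partrec.Code n).eval 0
  have hpow : Primrec₂ fun k n : ℕ => decide (2 ^ n = k) :=
    Primrec.eq.decide.comp₂
      ((Primrec₂.unpaired'.1 Nat.Primrec.pow).comp₂ (Primrec₂.const 2) Primrec₂.right)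
      Primrec₂.left
  have hf : Partrec f :=
    (Partrec.rfind hpow.to_comp.partrec₂).bind
      (Nat.Partrec.Code.eval_part.comp ((Computable.ofNat _).comp Computable.snd)
        (Computable.const 0)).to₂
  obtain ⟨c, hc⟩ := ToPartrec.Code.exists_code (Nat.Partrec'.part_iff₁.2 hf)
  have hdom : ∀ n, (c.eval [2 ^ n]).Dom ↔ ((Denumerable.ofNat Nat.Partrec.Code n).eval 0).Dom := by
    intro n
    have h1 : c.eval [2 ^ n] = pure <$> f (2 ^ n) := hc ⟨[2 ^ n], rfl⟩
    have h2 : (Nat.rfind fun j => Part.some (decide (2 ^ j = 2 ^ n))) = Part.some n := by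
      refine Part.eq_some_iff.2 (Nat.mem_rfind.2 ⟨by simp, fun {j} hj => ?_⟩)
      have : 2 ^ j ≠ 2 ^ n := fun h => hj.ne (Nat.pow_right_injective le_rfl h)
      simp [this]
    have h3 : f (2 ^ n) = (Denumerable.ofNat Nat.Partrec.Code n).eval 0 := by
      simp only [f]
      rw [h2, Part.bind_some]
    rw [h1, h3]
    rfl
  obtain ⟨Γ, Λ, h1, h2, h3, h4, M, a₀, a₁, a₂, hM⟩ := exists_machine_of_code c
  refine ⟨Γ, Λ, h1, h2, h3, h4, M, a₀, a₁, a₂, fun hcomp => ?_⟩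
  simp only [hM, hdom] at hcomp
  refine ComputablePred.halting_problem 0 ?_
  obtain ⟨g, hg, hP⟩ := ComputablePred.computable_iff.1 hcomp
  refine ComputablePred.computable_iff.2 ⟨_, hg.comp Computable.encode, funext fun d => ?_⟩
  simpa using congrFun hP (Encodable.encode d)

theorem exists_undecidable_rowSystem :
    ∃ (m : ℕ) (D : RowSystem m), ¬ ComputablePred fun n => ∃ α e p P, D.IsTrace n α e p P := by
  obtain ⟨Γ, Λ, _, _, _, _, M, a₀, a₁, a₂, hM⟩ := exists_undecidable_machine
  refine ⟨_, Diagram.rowSystem M a₀ a₁ a₂, fun h => hM (h.of_eq fun n => ?_)⟩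
  exact ⟨fun ⟨_, _, _, _, hT⟩ => Diagram.eval_dom_of_isTrace hT,
    Diagram.exists_isTrace_of_eval_dom⟩

end Undecidable

end OmegaUnif

theorem mainTheorem1 :
    (¬ ComputablePred (OmegaUnif.TransducerCode.UniformizableBy OmegaUnif.IsContinuousFun) ∧
      ¬ ComputablePred (OmegaUnif.TransducerCode.UniformizableBy OmegaUnif.IsComputableFun) ∧
      ¬ ComputablePred (OmegaUnif.TransducerCode.UniformizableBy OmegaUnif.IsSequentialFun) ∧
      ¬ ComputablePred (OmegaUnif.TransducerCode.UniformizableBy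
          OmegaUnif.IsLetterToLetterSequentialFun)) ∧
    (¬ OmegaUnif.DecidableOn OmegaUnif.TransducerCode.HasTotalDomain
        (OmegaUnif.TransducerCode.UniformizableBy OmegaUnif.IsContinuousFun) ∧
      ¬ OmegaUnif.DecidableOn OmegaUnif.TransducerCode.HasTotalDomain
        (OmegaUnif.TransducerCode.UniformizableBy OmegaUnif.IsComputableFun) ∧
      ¬ OmegaUnif.DecidableOn OmegaUnif.TransducerCode.HasTotalDomain
        (OmegaUnif.TransducerCode.UniformizableBy OmegaUnif.IsSequentialFun) ∧
      ¬ OmegaUnif.DecidableOn OmegaUnif.TransducerCode.HasTotalDomain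
        (OmegaUnif.TransducerCode.UniformizableBy
          OmegaUnif.IsLetterToLetterSequentialFun)) := by
  obtain ⟨m, D, hD⟩ := OmegaUnif.exists_undecidable_rowSystem
  have h1 := D.not_decidableOn_uniformizableBy hD OmegaUnif.IsContinuousFun (fun _ h => h)
    fun _ => OmegaUnif.isContinuousFun_truncateFun
  have h2 := D.not_decidableOn_uniformizableBy hD OmegaUnif.IsComputableFun
    (fun _ h => h.isContinuousFun) fun _ => OmegaUnif.isComputableFun_truncateFun
  have h3 := D.not_decidableOn_uniformizableBy hD OmegaUnif.IsSequentialFun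
    (fun _ h => h.isContinuousFun)
    fun _ => OmegaUnif.isLetterToLetterSequentialFun_truncateFun.isSequentialFun
  have h4 := D.not_decidableOn_uniformizableBy hD OmegaUnif.IsLetterToLetterSequentialFun
    (fun _ h => h.isSequentialFun.isContinuousFun)
    fun _ => OmegaUnif.isLetterToLetterSequentialFun_truncateFun
  -- An algorithm for all transducers is in particular correct on those with total domain.
  exact ⟨⟨fun h => h1 (OmegaUnif.ComputablePred.decidableOn _ h),
    fun h => h2 (OmegaUnif.ComputablePred.decidableOn _ h),
    fun h => h3 (OmegaUnif.ComputablePred.decidableOn _ h),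
    fun h => h4 (OmegaUnif.ComputablePred.decidableOn _ h)⟩, h1, h2, h3, h4⟩
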